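/- Conventions. For a bipartite operator $\rho$ on $W\otimes W$, $\dim W=K$, put $F(\rho)=\langle\phi^+|\rho|\phi^+\rangle$ with $\phi^+=K^{-1/2}\sum_{i}|i\rangle\otimes|i\rangle$. A separable superoperator from $V_1\otimes V_2$ to $W_1\otimes W_2$ is a map $\rho\mapsto\sum_i A_i\rho A_i^\dagger$ (finite sum) with $\sum_i A_i^\dagger A_i=\mathrm{Id}$ and each $A_i=A_i^{(1)}\otimes A_i^{(2)}$, $A_i^{(j)}:V_j\to W_j$ linear. For a state $\rho$ on $V\otimes V$, regard $\rho^{\otimes n}$ as a state on $V^{\otimes n}\otimes V^{\otimes n}$. The separably distillable entanglement $D_*(\rho)$ is the largest real $R$ for which there are integers $n_i,K_i\ge 1$ and separable superoperators $\mathcal P_i$ from $V^{\otimes n_i}\otimes V^{\otimes n_i}$ to $\mathbb C^{K_i}\otimes\mathbb C^{K_i}$ with $F(\mathcal P_i(\rho^{\otimes n_i}))\to 1$ and $\log_2(K_i)/n_i\to R$. Let $H_2(p)=-p\log_2p-(1-p)\log_2(1-p)$ (with $0\log_2 0=0$). Statement. Let $\chi=\sum_{k=0}^3\beta_k|b_k\rangle\langle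 b_k|$ be a Bell-diagonal two-qubit state, where $b_0,\dots,b_3$ are the four Bell vectors $(|00\rangle\pm|11\rangle)/\sqrt2$, $(|01\rangle\pm|10\rangle)/\sqrt2$ in any order, $\beta_0\ge\beta_1\ge\beta_2\ge\beta_3\ge0$, $\sum_k\beta_k=1$ and $\beta_0\ge 1/2$. Then: 1. The largest $R$ in the definition of $D_*(\chi)$ exists, and $D_*(\chi)\le 1-H_2(\beta_0)$. 2. If $\mathcal P_i$ are separable superoperators from $n_i+n_i$ qubits to $\mathbb C^{K_i}\otimes\mathbb C^{K_i}$ with $n_i\to\infty$, and for some $R>1-H_2(\beta_0)$ one has $\log_2(K_i)/n_i\ge R$ for all large $i$, then $F(\mathcal P_i(\chi^{\otimes n_i}))\to0$. 3. If $\beta_0<1$, let $\chi_0$ be the Bell-diagonal operator with the same eigenvectors $b_0,\dots,b_3$ and eigenvalues $\tfrac12,\ \tfrac{\beta_1}{2-2\beta_0},\ \tfrac{\beta_2}{2-2\beta_0},\ \tfrac{\beta_3}{2-2\beta_0}$. Its largest eigenvalue is $\tfrac12$, it is a separable state (a finite convex combination of product states), and $F(\mathcal P(\chi_0^{\otimes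 n}))\le 1/K$ for every $n\ge 0$, every $K$ and every separable superoperator $\mathcal P$ from $n+n$ qubits to $\mathbb C^K\otimes\mathbb C^K$. 4. The bound is tight when $\beta_2=\beta_3=0$: in that case $D_*(\chi)=1-H_2(\beta_0)$. -/

import Mathlib

open Filter Topology
open scoped Matrix Kronecker ComplexOrder

noncomputable section

/-- A density operator on the Hilbert space with orthonormal basis `α`. -/
def IsDensity {α : Type*} [Fintype α] (ρ : Matrix α α ℂ) : Prop :=
  ρ.PosSemidef ∧ ρ.trace = 1

/-- A separable state: a finite convex combination of product states. -/
def IsSeparableState {α β : Type*} [Fintype α] [Fintype β]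
    (ρ : Matrix (α × β) (α × β) ℂ) : Prop :=
  ∃ (r : ℕ) (w : Fin r → ℝ) (A : Fin r → Matrix α α ℂ) (B : Fin r → Matrix β β ℂ),
    (∀ i, 0 ≤ w i) ∧ ∑ i, w i = 1 ∧ (∀ i, IsDensity (A i)) ∧ (∀ i, IsDensity (B i)) ∧
      ρ = ∑ i, (w i : ℂ) • (A i ⊗ₖ B i)

/-- A separable superoperator from `V₁ ⊗ V₂` to `W₁ ⊗ W₂`: a map `ρ ↦ ∑ Aᵢ ρ Aᵢ†` with
`∑ Aᵢ† Aᵢ = 1` in which each `Aᵢ` is a tensor product of maps `V₁ → W₁` and `V₂ → W₂`. -/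
def IsSeparableSuperoperator {v₁ v₂ w₁ w₂ : Type*} [Fintype v₁] [Fintype v₂] [Fintype w₁]
    [Fintype w₂] [DecidableEq v₁] [DecidableEq v₂]
    (P : Matrix (v₁ × v₂) (v₁ × v₂) ℂ →ₗ[ℂ] Matrix (w₁ × w₂) (w₁ × w₂) ℂ) : Prop :=
  ∃ (r : ℕ) (A : Fin r → Matrix w₁ v₁ ℂ) (B : Fin r → Matrix w₂ v₂ ℂ),
    (∀ ρ, P ρ = ∑ i, (A i ⊗ₖ B i) * ρ * (A i ⊗ₖ B i)ᴴ) ∧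
      ∑ i, (A i ⊗ₖ B i)ᴴ * (A i ⊗ₖ B i) = 1

/-- The maximally entangled vector `(dim W)^(-1/2) ∑ᵢ |i⟩ ⊗ |i⟩`. -/
def maxEntangled (w : Type*) [Fintype w] [DecidableEq w] : w × w → ℂ :=
  fun x => if x.1 = x.2 then (((1 : ℝ) / Real.sqrt (Fintype.card w) : ℝ) : ℂ) else 0

/-- The entanglement fidelity `φ⁺† ρ φ⁺` (a real number for Hermitian `ρ`). -/
def fidelity {w : Type*} [Fintype w] [DecidableEq w] (ρ : Matrix (w × w) (w × w) ℂ) : ℝ :=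
  (star (maxEntangled w) ⬝ᵥ (ρ *ᵥ maxEntangled w)).re

/-- The state `ρ^{⊗ n}` of `n` copies of a bipartite system, as a state on
`V^{⊗ n} ⊗ V^{⊗ n}` (all first halves grouped together, and all second halves). -/
def tensorPower {v : Type*} (ρ : Matrix (v × v) (v × v) ℂ) (n : ℕ) :
    Matrix ((Fin n → v) × (Fin n → v)) ((Fin n → v) × (Fin n → v)) ℂ :=
  Matrix.of fun x y => ∏ k, ρ (x.1 k, x.2 k) (y.1 k, y.2 k)

/-- The rates at which separable superoperators, from `V^{⊗ nᵢ} ⊗ V^{⊗ nᵢ}` to `Wᵢ ⊗ Wᵢ` with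
`dim Wᵢ = Kᵢ`, distill entanglement from copies of `ρ` with fidelity tending to 1. -/
def separableRates {v : Type*} [Fintype v] [DecidableEq v]
    (ρ : Matrix (v × v) (v × v) ℂ) : Set ℝ :=
  {R | ∃ (n K : ℕ → ℕ)
      (P : ∀ i, Matrix ((Fin (n i) → v) × (Fin (n i) → v)) ((Fin (n i) → v) × (Fin (n i) → v)) ℂ
        →ₗ[ℂ] Matrix (Fin (K i) × Fin (K i)) (Fin (K i) × Fin (K i)) ℂ),
      (∀ i, 0 < n i) ∧ (∀ i, 0 < K i) ∧ (∀ i, IsSeparableSuperoperator (P i)) ∧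
      Tendsto (fun i => fidelity (P i (tensorPower ρ (n i)))) atTop (𝓝 1) ∧
      Tendsto (fun i => Real.logb 2 (K i) / (n i : ℝ)) atTop (𝓝 R)}

/-- The separably distillable entanglement `D_*(ρ)`. -/
def Dstar {v : Type*} [Fintype v] [DecidableEq v] (ρ : Matrix (v × v) (v × v) ℂ) : ℝ :=
  sSup (separableRates ρ)

/-- The four Bell vectors `(|00⟩ ± |11⟩)/√2`, `(|01⟩ ± |10⟩)/√2`. -/
def bellVec (k : Fin 4) : Fin 2 × Fin 2 → ℂ := fun x =>
  (((1 : ℝ) / Real.sqrt 2 : ℝ) : ℂ) *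
    (![!![1, 0; 0, 1], !![1, 0; 0, -1], !![0, 1; 1, 0], !![0, 1; -1, 0]] k :
      Matrix (Fin 2) (Fin 2) ℂ) x.1 x.2

/-- The Bell-diagonal operator in which the Bell vector with index `σ k` has eigenvalue `β k`. -/
def bellDiagonal (β : Fin 4 → ℝ) (σ : Equiv.Perm (Fin 4)) :
    Matrix (Fin 2 × Fin 2) (Fin 2 × Fin 2) ℂ :=
  ∑ k, (β k : ℂ) • Matrix.vecMulVec (bellVec (σ k)) (star (bellVec (σ k)))

/-- The binary entropy in bits. -/
def H₂ (p : ℝ) : ℝ := Real.binEntropy p / Real.log 2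

/-- The eigenvalues `1/2`, `β₁/(2-2β₀)`, `β₂/(2-2β₀)`, `β₃/(2-2β₀)`. -/
def comparisonEigenvalues (β : Fin 4 → ℝ) : Fin 4 → ℝ :=
  ![1 / 2, β 1 / (2 - 2 * β 0), β 2 / (2 - 2 * β 0), β 3 / (2 - 2 * β 0)]

end

/-! The converse is a comparison with a separable state. The projectors onto any two Bell vectors
sum to two projectors onto product vectors (`isProductPair_bellVec`), so a Bell-diagonal state with
an eigenvalue 1/2 is a mixture of product vectors. Product Kraus operators keep these vectors
product, and a unit product vector has squared overlap at most 1/K with `maxEntangled`. Hence a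
separable protocol reaches fidelity at most 1/K on copies of such a state. Take as reference a state
with eigenvalues q such that β = q ρ, where ρ is 2β₀ on the first Bell vector and 2(1 - β₀) on the
others. A protocol responds to each string J of Bell vectors with some t_J in [0, 1], whichever
source produced J. So it acts as a test between two classical i.i.d. sources: ∑ q_J t_J ≤ 1/K, while
∑ β_J t_J is the fidelity. The relative entropy of β to q is 1 - H₂(β₀) bits. Hölder's inequality
with exponent 1 + s (`fidelity_rpow_le`) and a suitable small s then make the fidelity exponentially
small in n once log₂ K / n is above that value. For tightness with two Bell states, local unitaries
make them differ by a bit flip, so n copies hide a classical error string of entropy n H₂(β₀).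
Comparing cosets of a linear code of size 2^k identifies the error among the roughly 2^(n H₂(β₀))
typical ones if k/n < 1 - H₂(β₀), and leaves a maximally entangled state of local dimension 2^k.
This is a one-way protocol, hence separable. The supremum is attained because the set of rates is
closed, nonempty and bounded above. -/

/-- The squared Euclidean norm of a vector given by its coordinates. -/
noncomputable def sqNorm {α : Type*} [Fintype α] (u : α → ℂ) : ℝ := ∑ x, ‖u x‖ ^ 2

/-- The projector (up to normalization) onto the line spanned by a vector. -/
def pureState {α : Type*} (u : α → ℂ) : Matrix α α ℂ := Matrix.vecMulVec u (star u)

/-- The product vector `a ⊗ b`. -/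
def prodVec {α β : Type*} (a : α → ℂ) (b : β → ℂ) : α × β → ℂ := fun x => a x.1 * b x.2

/-- The product vector `b (J 0) ⊗ ⋯ ⊗ b (J (n - 1))`, with the first halves grouped together. -/
def vecPow {ι v : Type*} (b : ι → v × v → ℂ) {n : ℕ} (J : Fin n → ι) :
    (Fin n → v) × (Fin n → v) → ℂ := fun x => ∏ k, b (J k) (x.1 k, x.2 k)

lemma sqNorm_nonneg {α : Type*} [Fintype α] (u : α → ℂ) : 0 ≤ sqNorm u :=
  Finset.sum_nonneg fun _ _ => sq_nonneg _

lemma star_dotProduct_self {α : Type*} [Fintype α] (u : α → ℂ) :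
    star u ⬝ᵥ u = (sqNorm u : ℂ) := by
  simp only [dotProduct, sqNorm, Pi.star_apply, Complex.ofReal_sum]
  refine Finset.sum_congr rfl fun x _ => ?_
  rw [Complex.star_def, Complex.conj_mul']
  push_cast; rfl

lemma sqNorm_prodVec {α β : Type*} [Fintype α] [Fintype β] (a : α → ℂ) (b : β → ℂ) :
    sqNorm (prodVec a b) = sqNorm a * sqNorm b := by
  simp only [sqNorm, prodVec, Fintype.sum_prod_type, Finset.sum_mul_sum, norm_mul, mul_pow]

lemma sqNorm_vecPow {ι v : Type*} [Fintype v] (b : ι → v × v → ℂ) {n : ℕ} (J : Fin n → ι) :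
    sqNorm (vecPow b J) = ∏ k, sqNorm (b (J k)) := by
  classical
  simp only [sqNorm, vecPow, norm_prod, ← Finset.prod_pow]
  rw [Finset.prod_univ_sum, Fintype.piFinset_univ]
  exact (Equiv.sum_comp (Equiv.arrowProdEquivProdArrow (Fin n) (fun _ => v) (fun _ => v))
    (fun x => ∏ k, ‖b (J k) (x.1 k, x.2 k)‖ ^ 2)).symm

lemma tensorPower_mixture {ι v : Type*} [Fintype ι] (w : ι → ℝ) (b : ι → v × v → ℂ) (n : ℕ) :
    tensorPower (∑ j, (w j : ℂ) • pureState (b j)) n =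
      ∑ J : Fin n → ι, ((∏ k, w (J k) : ℝ) : ℂ) • pureState (vecPow b J) := by
  classical
  ext x y
  simp only [tensorPower, Matrix.of_apply, Matrix.sum_apply, Matrix.smul_apply, pureState,
    Matrix.vecMulVec_apply, Pi.star_apply, smul_eq_mul]
  rw [Finset.prod_univ_sum, Fintype.piFinset_univ]
  refine Finset.sum_congr rfl fun J _ => ?_
  simp only [vecPow, Finset.prod_mul_distrib, star_prod, Complex.ofReal_prod]

lemma vecPow_prodVec {ι α : Type*} (a b : ι → α → ℂ) {n : ℕ} (J : Fin n → ι) :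
    vecPow (fun j => prodVec (a j) (b j)) J =
      prodVec (fun x => ∏ k, a (J k) (x k)) (fun x => ∏ k, b (J k) (x k)) := by
  ext x
  simp only [vecPow, prodVec, Finset.prod_mul_distrib]

lemma kronecker_mulVec_prodVec {α β γ δ : Type*} [Fintype α] [Fintype β]
    (A : Matrix γ α ℂ) (B : Matrix δ β ℂ) (a : α → ℂ) (b : β → ℂ) :
    (A ⊗ₖ B) *ᵥ prodVec a b = prodVec (A *ᵥ a) (B *ᵥ b) := by
  ext x
  simp only [Matrix.mulVec, dotProduct, prodVec, Fintype.sum_prod_type, Finset.sum_mul_sum,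
    Matrix.kroneckerMap_apply]
  exact Finset.sum_congr rfl fun i _ => Finset.sum_congr rfl fun j _ => by ring

lemma norm_dotProduct_sq_le {α : Type*} [Fintype α] (a b : α → ℂ) :
    ‖a ⬝ᵥ b‖ ^ 2 ≤ sqNorm a * sqNorm b := by
  refine le_trans ?_ (Finset.sum_mul_sq_le_sq_mul_sq Finset.univ (fun x => ‖a x‖) fun x => ‖b x‖)
  gcongr
  refine (norm_sum_le _ _).trans (le_of_eq ?_)
  simp

/-! ### Fidelity after a separable superoperator -/

section fidelity

variable {w : Type*} [Fintype w] [DecidableEq w]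

lemma sqNorm_maxEntangled_le : sqNorm (maxEntangled w) ≤ 1 := by
  simp only [sqNorm, maxEntangled, Fintype.sum_prod_type]
  have h : ∀ x y : w, ‖(if x = y then (((1 : ℝ) / Real.sqrt (Fintype.card w) : ℝ) : ℂ) else 0)‖ ^ 2
      = if x = y then 1 / (Fintype.card w : ℝ) else 0 := by
    intro x y
    split_ifs
    · rw [Complex.norm_real, Real.norm_eq_abs, sq_abs, div_pow, Real.sq_sqrt (Nat.cast_nonneg _),
        one_pow]
    · simp
  simp only [h, Finset.sum_ite_eq, Finset.mem_univ, if_true, Finset.sum_const, nsmul_eq_mul,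
    Finset.card_univ]
  rw [mul_one_div]
  exact div_self_le_one _

lemma star_maxEntangled_dotProduct (u : w × w → ℂ) :
    star (maxEntangled w) ⬝ᵥ u
      = (((1 : ℝ) / Real.sqrt (Fintype.card w) : ℝ) : ℂ) * ∑ x, u (x, x) := by
  simp only [dotProduct, Pi.star_apply, maxEntangled, Fintype.sum_prod_type, Finset.mul_sum]
  refine Finset.sum_congr rfl fun x _ => ?_
  rw [Finset.sum_eq_single x]
  · simp
  · intro y _ hy
    simp [Ne.symm hy]
  · simp

/-- The overlap is `a ⬝ᵥ b` divided by the root of the dimension, so Cauchy–Schwarz applies. This is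
the origin of the factor 1/K. -/
lemma norm_maxEntangled_dotProduct_prodVec_sq_le (a b : w → ℂ) :
    ‖star (maxEntangled w) ⬝ᵥ prodVec a b‖ ^ 2
      ≤ 1 / (Fintype.card w : ℝ) * sqNorm (prodVec a b) := by
  rw [star_maxEntangled_dotProduct, norm_mul, mul_pow, Complex.norm_real, Real.norm_eq_abs,
    sq_abs, div_pow, Real.sq_sqrt (Nat.cast_nonneg _), one_pow, sqNorm_prodVec]
  gcongr
  exact norm_dotProduct_sq_le a b

lemma norm_maxEntangled_dotProduct_sq_le (u : w × w → ℂ) :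
    ‖star (maxEntangled w) ⬝ᵥ u‖ ^ 2 ≤ sqNorm u := by
  refine (norm_dotProduct_sq_le _ _).trans ?_
  have h : sqNorm (star (maxEntangled w)) = sqNorm (maxEntangled w) := by
    simp [sqNorm]
  rw [h]
  exact mul_le_of_le_one_left (sqNorm_nonneg _) sqNorm_maxEntangled_le

lemma fidelity_sum {ι : Type*} (s : Finset ι) (M : ι → Matrix (w × w) (w × w) ℂ) :
    fidelity (∑ j ∈ s, M j) = ∑ j ∈ s, fidelity (M j) := by
  simp only [fidelity, Matrix.sum_mulVec, dotProduct_sum, Complex.re_sum]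

lemma fidelity_smul (c : ℝ) (M : Matrix (w × w) (w × w) ℂ) :
    fidelity ((c : ℂ) • M) = c * fidelity M := by
  simp [fidelity, Matrix.smul_mulVec, dotProduct_smul]

/-- Each Kraus operator keeps a pure state pure, so its contribution is a squared amplitude; this
also gives nonnegativity. -/
lemma fidelity_conj {α : Type*} [Fintype α] (A : Matrix (w × w) α ℂ) (u : α → ℂ) :
    fidelity (A * pureState u * Aᴴ) = ‖star (maxEntangled w) ⬝ᵥ (A *ᵥ u)‖ ^ 2 := by
  have h1 : A * pureState u * Aᴴ = pureState (A *ᵥ u) := by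
    rw [pureState, pureState, Matrix.mul_vecMulVec, Matrix.vecMulVec_mul, Matrix.star_mulVec]
  rw [h1, fidelity, pureState, Matrix.vecMulVec_mulVec]
  set z := star (maxEntangled w) ⬝ᵥ (A *ᵥ u) with hz
  have h2 : star (A *ᵥ u) ⬝ᵥ maxEntangled w = star z := by
    rw [hz, Matrix.star_dotProduct]
  rw [h2]
  simp only [dotProduct_smul, ← hz]
  simp [Complex.mul_conj, Complex.normSq_eq_norm_sq, -Complex.ofReal_pow]

variable {v₁ v₂ : Type*} [Fintype v₁] [Fintype v₂] [DecidableEq v₁] [DecidableEq v₂]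

lemma sum_sqNorm_kraus {α β : Type*} [Fintype α] [Fintype β] [DecidableEq α] {r : Type*}
    [Fintype r] (C : r → Matrix β α ℂ) (h : ∑ i, (C i)ᴴ * C i = 1) (u : α → ℂ) :
    ∑ i, sqNorm (C i *ᵥ u) = sqNorm u := by
  have h1 : ((∑ i, sqNorm (C i *ᵥ u) : ℝ) : ℂ) = (sqNorm u : ℂ) := by
    rw [← star_dotProduct_self u]
    rw [show star u ⬝ᵥ u = star u ⬝ᵥ ((∑ i, (C i)ᴴ * C i) *ᵥ u) by rw [h, Matrix.one_mulVec],
      Complex.ofReal_sum, Matrix.sum_mulVec, dotProduct_sum]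
    refine Finset.sum_congr rfl fun i _ => ?_
    rw [← star_dotProduct_self, Matrix.star_mulVec, ← Matrix.mulVec_mulVec,
      Matrix.dotProduct_mulVec]
    simp only [Matrix.dotProduct_mulVec, Matrix.vecMul_vecMul]
  exact_mod_cast h1

lemma IsSeparableSuperoperator.fidelity_pureState_nonneg
    {P : Matrix (v₁ × v₂) (v₁ × v₂) ℂ →ₗ[ℂ] Matrix (w × w) (w × w) ℂ}
    (hP : IsSeparableSuperoperator P) (u : v₁ × v₂ → ℂ) : 0 ≤ fidelity (P (pureState u)) := by
  obtain ⟨r, A, B, hP, -⟩ := hP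
  rw [hP, fidelity_sum]
  simp only [fidelity_conj]
  positivity

lemma IsSeparableSuperoperator.fidelity_pureState_le
    {P : Matrix (v₁ × v₂) (v₁ × v₂) ℂ →ₗ[ℂ] Matrix (w × w) (w × w) ℂ}
    (hP : IsSeparableSuperoperator P) (u : v₁ × v₂ → ℂ) :
    fidelity (P (pureState u)) ≤ sqNorm u := by
  obtain ⟨r, A, B, hP, h1⟩ := hP
  rw [hP, fidelity_sum, ← sum_sqNorm_kraus _ h1]
  simp only [fidelity_conj]
  exact Finset.sum_le_sum fun i _ => norm_maxEntangled_dotProduct_sq_le _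

/-- The only bound that uses the product form of the Kraus operators: they send product vectors to
product vectors, and the completeness relation adds up the norms. -/
lemma IsSeparableSuperoperator.fidelity_pureState_prodVec_le
    {P : Matrix (v₁ × v₂) (v₁ × v₂) ℂ →ₗ[ℂ] Matrix (w × w) (w × w) ℂ}
    (hP : IsSeparableSuperoperator P) (a : v₁ → ℂ) (b : v₂ → ℂ) :
    fidelity (P (pureState (prodVec a b)))
      ≤ 1 / (Fintype.card w : ℝ) * sqNorm (prodVec a b) := by
  obtain ⟨r, A, B, hP, h1⟩ := hP
  rw [hP, fidelity_sum, ← sum_sqNorm_kraus _ h1, Finset.mul_sum]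
  simp only [fidelity_conj, kronecker_mulVec_prodVec]
  exact Finset.sum_le_sum fun i _ => norm_maxEntangled_dotProduct_prodVec_sq_le _ _

end fidelity

/-! ### Tensor powers of mixtures -/

section tensorPower

variable {v w ι : Type*} [Fintype w] [DecidableEq w] [Fintype ι]

/-- Makes the problem classical: the protocol enters only through its response to each string of
vectors, independently of the weights `p`. -/
lemma fidelity_tensorPower_mixture {n : ℕ}
    (P : Matrix ((Fin n → v) × (Fin n → v)) ((Fin n → v) × (Fin n → v)) ℂ
      →ₗ[ℂ] Matrix (w × w) (w × w) ℂ) (p : ι → ℝ) (b : ι → v × v → ℂ) :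
    fidelity (P (tensorPower (∑ j, (p j : ℂ) • pureState (b j)) n)) =
      ∑ J : Fin n → ι, (∏ k, p (J k)) * fidelity (P (pureState (vecPow b J))) := by
  rw [tensorPower_mixture, map_sum, fidelity_sum]
  simp only [map_smul, fidelity_smul]

lemma sum_prod_eq_pow (p : ι → ℝ) (n : ℕ) : ∑ J : Fin n → ι, ∏ k, p (J k) = (∑ j, p j) ^ n := by
  classical
  rw [Finset.sum_pow', Fintype.piFinset_univ]

lemma IsSeparableSuperoperator.fidelity_le_one_div_card [Fintype v] [DecidableEq v] {n : ℕ}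
    {P : Matrix ((Fin n → v) × (Fin n → v)) ((Fin n → v) × (Fin n → v)) ℂ
      →ₗ[ℂ] Matrix (w × w) (w × w) ℂ} (hP : IsSeparableSuperoperator P)
    (p : ι → ℝ) (hp : ∀ j, 0 ≤ p j) (hp1 : ∑ j, p j = 1) (a b : ι → v → ℂ)
    (ha : ∀ j, sqNorm (a j) = 1) (hb : ∀ j, sqNorm (b j) = 1) :
    fidelity (P (tensorPower (∑ j, (p j : ℂ) • pureState (prodVec (a j) (b j))) n))
      ≤ 1 / (Fintype.card w : ℝ) := by
  rw [fidelity_tensorPower_mixture]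
  calc _ ≤ ∑ J : Fin n → ι, (∏ k, p (J k)) * (1 / (Fintype.card w : ℝ)) := by
        refine Finset.sum_le_sum fun J _ => ?_
        refine mul_le_mul_of_nonneg_left ?_ (Finset.prod_nonneg fun k _ => hp _)
        have h := sqNorm_vecPow (fun j => prodVec (a j) (b j)) J
        simp only [sqNorm_prodVec, ha, hb, mul_one, Finset.prod_const_one] at h
        rw [vecPow_prodVec] at h ⊢
        simpa [h] using hP.fidelity_pureState_prodVec_le (fun x => ∏ k, a (J k) (x k))
          (fun x => ∏ k, b (J k) (x k))
    _ = 1 / (Fintype.card w : ℝ) := by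
        rw [← Finset.sum_mul, sum_prod_eq_pow, hp1, one_pow, one_mul]

lemma isDensity_pureState {α : Type*} [Fintype α] {u : α → ℂ} (hu : sqNorm u = 1) :
    IsDensity (pureState u) := by
  refine ⟨Matrix.posSemidef_vecMulVec_self_star u, ?_⟩
  rw [pureState, Matrix.trace_vecMulVec, dotProduct_comm, star_dotProduct_self, hu,
    Complex.ofReal_one]

lemma isSeparableState_mixture [Fintype v] (p : ι → ℝ) (hp : ∀ j, 0 ≤ p j) (hp1 : ∑ j, p j = 1)
    (a b : ι → v → ℂ) (ha : ∀ j, sqNorm (a j) = 1) (hb : ∀ j, sqNorm (b j) = 1) :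
    IsSeparableState (∑ j, (p j : ℂ) • pureState (prodVec (a j) (b j))) := by
  let e := (Fintype.equivFin ι).symm
  refine ⟨Fintype.card ι, fun i => p (e i), fun i => pureState (a (e i)),
    fun i => pureState (b (e i)), fun i => hp _, ?_, fun i => isDensity_pureState (ha _),
    fun i => isDensity_pureState (hb _), ?_⟩
  · rw [← hp1]
    exact e.sum_comp p
  · rw [← e.sum_comp]
    refine Finset.sum_congr rfl fun i _ => ?_
    congr 1
    ext x y
    simp only [pureState, prodVec, Matrix.vecMulVec_apply, Pi.star_apply, star_mul',
      Matrix.kroneckerMap_apply]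
    ring

end tensorPower

/-! ### Bell states and product vectors -/

lemma bellDiagonal_eq (q : Fin 4 → ℝ) (σ : Equiv.Perm (Fin 4)) :
    bellDiagonal q σ = ∑ k, (q k : ℂ) • pureState (bellVec (σ k)) := rfl

/-- The normalization factor `1 / √2` of the Bell vectors. -/
noncomputable def invSqrtTwo : ℂ := (((1 : ℝ) / Real.sqrt 2 : ℝ) : ℂ)

lemma invSqrtTwo_mul_self : invSqrtTwo * invSqrtTwo = 1 / 2 := by
  rw [invSqrtTwo, ← Complex.ofReal_mul, div_mul_div_comm, Real.mul_self_sqrt (by norm_num)]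
  norm_num

lemma conj_invSqrtTwo : (starRingEnd ℂ) invSqrtTwo = invSqrtTwo := Complex.conj_ofReal _

lemma norm_invSqrtTwo_sq : ‖invSqrtTwo‖ ^ 2 = 1 / 2 := by
  rw [← norm_pow, sq, invSqrtTwo_mul_self]
  norm_num

lemma bellVec_apply (k : Fin 4) (x y : Fin 2) : bellVec k (x, y) = invSqrtTwo *
    (![!![1, 0; 0, 1], !![1, 0; 0, -1], !![0, 1; 1, 0], !![0, 1; -1, 0]] k :
      Matrix (Fin 2) (Fin 2) ℂ) x y := rfl

lemma sqNorm_bellVec (k : Fin 4) : sqNorm (bellVec k) = 1 := by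
  fin_cases k <;>
    simp [sqNorm, bellVec_apply, Fintype.sum_prod_type, Fin.sum_univ_two, norm_invSqrtTwo_sq] <;>
    norm_num

/-- The unit vector `(1, c) / √2` for a phase `c`. -/
noncomputable def phaseVec (c : ℂ) : Fin 2 → ℂ := ![invSqrtTwo, invSqrtTwo * c]

lemma sqNorm_phaseVec {c : ℂ} (hc : ‖c‖ = 1) : sqNorm (phaseVec c) = 1 := by
  simp [sqNorm, phaseVec, Fin.sum_univ_two, hc, norm_invSqrtTwo_sq]
  norm_num

lemma sqNorm_single (i : Fin 2) : sqNorm (Pi.single i 1 : Fin 2 → ℂ) = 1 := by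
  fin_cases i <;> simp [sqNorm, Fin.sum_univ_two]

/-- A sum of two projectors onto product vectors. -/
def IsProductPair (M : Matrix (Fin 2 × Fin 2) (Fin 2 × Fin 2) ℂ) : Prop :=
  ∃ a b : Fin 2 → Fin 2 → ℂ, (∀ e, sqNorm (a e) = 1) ∧ (∀ e, sqNorm (b e) = 1) ∧
    M = ∑ e, pureState (prodVec (a e) (b e))

lemma isProductPair_single (f : Fin 2 → Fin 2)
    (M : Matrix (Fin 2 × Fin 2) (Fin 2 × Fin 2) ℂ)
    (h : ∀ x x' y y', M (x, x') (y, y') = ∑ e, prodVec (Pi.single e 1) (Pi.single (f e) 1) (x, x')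
      * star (prodVec (Pi.single e 1) (Pi.single (f e) 1) (y, y'))) : IsProductPair M := by
  refine ⟨fun e => Pi.single e 1, fun e => Pi.single (f e) 1, fun _ => sqNorm_single _,
    fun _ => sqNorm_single _, ?_⟩
  ext ⟨x, x'⟩ ⟨y, y'⟩
  rw [h, Matrix.sum_apply]
  rfl

lemma isProductPair_phaseVec (c d : ℂ) (hc : ‖c‖ = 1) (hd : ‖d‖ = 1)
    (M : Matrix (Fin 2 × Fin 2) (Fin 2 × Fin 2) ℂ)
    (h : ∀ x x' y y', M (x, x') (y, y') =
      phaseVec c x * phaseVec d x' * star (phaseVec c y * phaseVec d y') +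
      phaseVec (-c) x * phaseVec (-d) x' * star (phaseVec (-c) y * phaseVec (-d) y')) :
    IsProductPair M := by
  refine ⟨![phaseVec c, phaseVec (-c)], ![phaseVec d, phaseVec (-d)],
    fun e => by fin_cases e <;> simp [sqNorm_phaseVec, hc],
    fun e => by fin_cases e <;> simp [sqNorm_phaseVec, hd], ?_⟩
  ext ⟨x, x'⟩ ⟨y, y'⟩
  rw [h, Matrix.sum_apply, Fin.sum_univ_two]
  rfl

lemma pureState_bellVec_apply (i : Fin 4) (x x' y y' : Fin 2) :
    pureState (bellVec i) (x, x') (y, y') = bellVec i (x, x') * star (bellVec i (y, y')) := rfl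

/-- Two Bell vectors share their eigenvalue for exactly one of Z⊗Z, X⊗X, Y⊗Y and span that
eigenspace. It also has an orthonormal basis of two product vectors, built from eigenvectors of the
Pauli matrix; the phases ±1 and ±i are those of X and Y. -/
lemma isProductPair_bellVec_of_lt {i j : Fin 4} (hij : i < j) :
    IsProductPair (pureState (bellVec i) + pureState (bellVec j)) := by
  have hs := invSqrtTwo_mul_self
  have hI := Complex.I_mul_I
  have h01 : IsProductPair (pureState (bellVec 0) + pureState (bellVec 1)) := by
    refine isProductPair_single ![0, 1] _ fun x x' y y' => ?_
    rw [Matrix.add_apply, pureState_bellVec_apply, pureState_bellVec_apply]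
    simp only [bellVec_apply, prodVec, Fin.sum_univ_two]
    fin_cases x <;> fin_cases x' <;> fin_cases y <;> fin_cases y' <;>
      simp [conj_invSqrtTwo] <;> grind
  have h23 : IsProductPair (pureState (bellVec 2) + pureState (bellVec 3)) := by
    refine isProductPair_single ![1, 0] _ fun x x' y y' => ?_
    rw [Matrix.add_apply, pureState_bellVec_apply, pureState_bellVec_apply]
    simp only [bellVec_apply, prodVec, Fin.sum_univ_two]
    fin_cases x <;> fin_cases x' <;> fin_cases y <;> fin_cases y' <;>
      simp [conj_invSqrtTwo] <;> grind
  have h02 : IsProductPair (pureState (bellVec 0) + pureState (bellVec 2)) := by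
    refine isProductPair_phaseVec 1 1 (by simp) (by simp) _ fun x x' y y' => ?_
    rw [Matrix.add_apply, pureState_bellVec_apply, pureState_bellVec_apply]
    simp only [bellVec_apply, phaseVec]
    fin_cases x <;> fin_cases x' <;> fin_cases y <;> fin_cases y' <;>
      simp [conj_invSqrtTwo] <;> grind
  have h13 : IsProductPair (pureState (bellVec 1) + pureState (bellVec 3)) := by
    refine isProductPair_phaseVec (-1) 1 (by simp) (by simp) _ fun x x' y y' => ?_
    rw [Matrix.add_apply, pureState_bellVec_apply, pureState_bellVec_apply]
    simp only [bellVec_apply, phaseVec]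
    fin_cases x <;> fin_cases x' <;> fin_cases y <;> fin_cases y' <;>
      simp [conj_invSqrtTwo] <;> grind
  have h03 : IsProductPair (pureState (bellVec 0) + pureState (bellVec 3)) := by
    refine isProductPair_phaseVec (-Complex.I) Complex.I (by simp) (by simp) _ fun x x' y y' => ?_
    rw [Matrix.add_apply, pureState_bellVec_apply, pureState_bellVec_apply]
    simp only [bellVec_apply, phaseVec]
    fin_cases x <;> fin_cases x' <;> fin_cases y <;> fin_cases y' <;>
      simp [conj_invSqrtTwo] <;> grind
  have h12 : IsProductPair (pureState (bellVec 1) + pureState (bellVec 2)) := by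
    refine isProductPair_phaseVec Complex.I Complex.I (by simp) (by simp) _ fun x x' y y' => ?_
    rw [Matrix.add_apply, pureState_bellVec_apply, pureState_bellVec_apply]
    simp only [bellVec_apply, phaseVec]
    fin_cases x <;> fin_cases x' <;> fin_cases y <;> fin_cases y' <;>
      simp [conj_invSqrtTwo] <;> grind
  fin_cases i <;> fin_cases j <;> first | exact absurd hij (by decide) | assumption

lemma isProductPair_bellVec {i j : Fin 4} (hij : i ≠ j) :
    IsProductPair (pureState (bellVec i) + pureState (bellVec j)) := by
  rcases lt_or_gt_of_ne hij with h | h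
  · exact isProductPair_bellVec_of_lt h
  · rw [add_comm]
    exact isProductPair_bellVec_of_lt h

/-- Bell-diagonal operators with an eigenvalue `1/2` are mixtures of product vectors. -/
lemma bellDiagonal_eq_product_mixture (q : Fin 4 → ℝ) (σ : Equiv.Perm (Fin 4))
    (hq : ∀ k, 0 ≤ q k) (hq0 : q 0 = 1 / 2) (hsum : ∑ k, q k = 1) :
    ∃ (p : Fin 3 × Fin 2 → ℝ) (a b : Fin 3 × Fin 2 → Fin 2 → ℂ),
      (∀ j, 0 ≤ p j) ∧ ∑ j, p j = 1 ∧ (∀ j, sqNorm (a j) = 1) ∧ (∀ j, sqNorm (b j) = 1) ∧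
      bellDiagonal q σ = ∑ j, (p j : ℂ) • pureState (prodVec (a j) (b j)) := by
  have h : ∀ k : Fin 3, IsProductPair (pureState (bellVec (σ 0)) + pureState (bellVec (σ k.succ))) :=
    fun k => isProductPair_bellVec (σ.injective.ne (Fin.succ_ne_zero k).symm)
  choose a b ha hb hab using h
  rw [Fin.sum_univ_succ, hq0] at hsum
  -- The weight 1/2 of the first Bell state equals the total weight of the other three, so it can be
  -- shared among them: each `q k.succ` multiplies the sum of two Bell projectors, which is a
  -- product pair.
  have hsum' : ∑ k : Fin 3, q k.succ = 1 / 2 := by linarith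
  refine ⟨fun j => q j.1.succ, fun j => a j.1 j.2, fun j => b j.1 j.2, fun j => hq _, ?_,
    fun j => ha _ _, fun j => hb _ _, ?_⟩
  · simp only [Fintype.sum_prod_type, Finset.sum_const, Finset.card_univ, Fintype.card_fin,
      ← Finset.smul_sum, hsum']
    norm_num
  · simp only [Fintype.sum_prod_type, ← Finset.smul_sum, ← hab, smul_add, Finset.sum_add_distrib,
      ← Finset.sum_smul]
    rw [bellDiagonal_eq, Fin.sum_univ_succ, hq0, ← hsum', Complex.ofReal_sum]

/-! ### Exponential moments and the strong converse -/

/-- If `ℓ` has mean less than `r`, then some exponential moment of `ℓ - r` is less than one. -/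
lemma exists_exp_moment_lt_one {ι : Type*} [Fintype ι] (p ℓ : ι → ℝ) (hp : ∑ j, p j = 1) {r : ℝ}
    (h : ∑ j, p j * ℓ j < r) :
    ∃ s, 0 < s ∧ s ≤ 1 ∧ ∑ j, p j * Real.exp (s * (ℓ j - r)) < 1 := by
  -- The moment equals 1 at s = 0 and has derivative (mean of ℓ) - r < 0 there, so it drops below 1
  -- just to the right of 0.
  have hd : HasDerivAt (fun s : ℝ => ∑ j, p j * Real.exp (s * (ℓ j - r)))
      (∑ j, p j * (Real.exp (0 * (ℓ j - r)) * (1 * (ℓ j - r)))) 0 :=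
    HasDerivAt.fun_sum fun j _ => (((hasDerivAt_id (0 : ℝ)).mul_const (ℓ j - r)).exp).const_mul _
  have hneg : ∑ j, p j * (Real.exp (0 * (ℓ j - r)) * (1 * (ℓ j - r))) < 0 := by
    simp only [zero_mul, Real.exp_zero, one_mul]
    simp only [mul_sub, Finset.sum_sub_distrib, ← Finset.sum_mul, hp]
    linarith
  have hs := hd.tendsto_slope.mono_left (nhdsWithin_mono 0 fun x (hx : 0 < x) => hx.ne')
  have h1 : ∀ᶠ s in 𝓝[>] (0 : ℝ), slope (fun s : ℝ => ∑ j, p j * Real.exp (s * (ℓ j - r))) 0 s < 0 :=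
    hs.eventually (gt_mem_nhds hneg)
  have h2 : ∀ᶠ s in 𝓝[>] (0 : ℝ), s < 1 := nhdsWithin_le_nhds (gt_mem_nhds one_pos)
  obtain ⟨s, hs1, hs2, hs0⟩ := (h1.and (h2.and self_mem_nhdsWithin)).exists
  have hs0 : 0 < s := hs0
  refine ⟨s, hs0, hs2.le, ?_⟩
  rw [slope_def_field, sub_zero, div_neg_iff] at hs1
  rcases hs1 with ⟨_, h⟩ | ⟨h, _⟩
  · linarith
  · simpa [hp] using h

section converse

variable {v w ι : Type*} [Fintype v] [DecidableEq v] [Fintype w] [DecidableEq w] [Fintype ι]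

lemma IsSeparableSuperoperator.fidelity_mixture_mem_Icc {n : ℕ}
    {P : Matrix ((Fin n → v) × (Fin n → v)) ((Fin n → v) × (Fin n → v)) ℂ
      →ₗ[ℂ] Matrix (w × w) (w × w) ℂ} (hP : IsSeparableSuperoperator P)
    (p : ι → ℝ) (hp : ∀ j, 0 ≤ p j) (hp1 : ∑ j, p j = 1) (b : ι → v × v → ℂ)
    (hb : ∀ j, sqNorm (b j) = 1) :
    fidelity (P (tensorPower (∑ j, (p j : ℂ) • pureState (b j)) n)) ∈ Set.Icc (0 : ℝ) 1 := by
  rw [fidelity_tensorPower_mixture]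
  refine ⟨Finset.sum_nonneg fun J _ => mul_nonneg (Finset.prod_nonneg fun k _ => hp _)
    (hP.fidelity_pureState_nonneg _), ?_⟩
  calc _ ≤ ∑ J : Fin n → ι, ∏ k, p (J k) := Finset.sum_le_sum fun J _ =>
        mul_le_of_le_one_right (Finset.prod_nonneg fun k _ => hp _)
          ((hP.fidelity_pureState_le _).trans (by simp [sqNorm_vecPow, hb]))
    _ = 1 := by rw [sum_prod_eq_pow, hp1, one_pow]

/-- A Hölder bound on the fidelity reached from a diagonal mixture, in terms of the fidelity
reached from a reference mixture of the same vectors. -/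
lemma IsSeparableSuperoperator.fidelity_rpow_le {n : ℕ}
    {P : Matrix ((Fin n → v) × (Fin n → v)) ((Fin n → v) × (Fin n → v)) ℂ
      →ₗ[ℂ] Matrix (w × w) (w × w) ℂ} (hP : IsSeparableSuperoperator P)
    (q ρ : ι → ℝ) (hq : ∀ j, 0 ≤ q j) (hρ : ∀ j, 0 ≤ ρ j) (b : ι → v × v → ℂ)
    (hb : ∀ j, sqNorm (b j) = 1) {s : ℝ} (hs : 0 < s) {G : ℝ}
    (hG : fidelity (P (tensorPower (∑ j, (q j : ℂ) • pureState (b j)) n)) ≤ G) :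
    fidelity (P (tensorPower (∑ j, ((q j * ρ j : ℝ) : ℂ) • pureState (b j)) n)) ^ (1 + s) ≤
      G ^ s * (∑ j, q j * ρ j ^ (1 + s)) ^ n := by
  rw [fidelity_tensorPower_mixture] at hG ⊢
  set t : (Fin n → ι) → ℝ := fun J => fidelity (P (pureState (vecPow b J)))
  have ht0 : ∀ J, 0 ≤ t J := fun J => hP.fidelity_pureState_nonneg _
  have ht1 : ∀ J, t J ≤ 1 := fun J => by
    refine (hP.fidelity_pureState_le _).trans (le_of_eq ?_)
    simp [sqNorm_vecPow, hb]
  have hqJ : ∀ J : Fin n → ι, 0 ≤ ∏ k, q (J k) := fun J => Finset.prod_nonneg fun k _ => hq _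
  have hρJ : ∀ J : Fin n → ι, 0 ≤ ∏ k, ρ (J k) := fun J => Finset.prod_nonneg fun k _ => hρ _
  have hG0 : 0 ≤ ∑ J : Fin n → ι, (∏ k, q (J k)) * t J :=
    Finset.sum_nonneg fun J _ => mul_nonneg (hqJ J) (ht0 J)
  -- Here `t J ≤ 1` is used to discard the protocol, after which the moment factorizes over copies.
  have hmom : ∑ J : Fin n → ι, (∏ k, q (J k)) * t J * (∏ k, ρ (J k)) ^ (1 + s) ≤
      (∑ j, q j * ρ j ^ (1 + s)) ^ n := by
    rw [← sum_prod_eq_pow]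
    refine Finset.sum_le_sum fun J _ => ?_
    rw [Finset.prod_mul_distrib, Real.finsetProd_rpow _ _ fun k _ => hρ _]
    exact mul_le_mul_of_nonneg_right (mul_le_of_le_one_right (hqJ J) (ht1 J))
      (Real.rpow_nonneg (hρJ J) _)
  -- Hölder with weights q_J t_J applied to ρ_J. The total weight is the fidelity on the reference
  -- state, bounded by `G`.
  have hH := Real.inner_le_weight_mul_Lp_of_nonneg Finset.univ (p := 1 + s) (by linarith)
    (fun J : Fin n → ι => (∏ k, q (J k)) * t J) (fun J => ∏ k, ρ (J k))
    (fun J => mul_nonneg (hqJ J) (ht0 J)) hρJ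
  have heq : ∑ J : Fin n → ι, (∏ k, q (J k) * ρ (J k)) * t J =
      ∑ J : Fin n → ι, (∏ k, q (J k)) * t J * ∏ k, ρ (J k) :=
    Finset.sum_congr rfl fun J _ => by rw [Finset.prod_mul_distrib]; ring
  have h1s : 0 < 1 + s := by linarith
  have hA : 0 ≤ ∑ J : Fin n → ι, (∏ k, q (J k)) * t J * (∏ k, ρ (J k)) ^ (1 + s) :=
    Finset.sum_nonneg fun J _ =>
      mul_nonneg (mul_nonneg (hqJ J) (ht0 J)) (Real.rpow_nonneg (hρJ J) _)
  rw [heq]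
  calc _ ≤ ((∑ J : Fin n → ι, (∏ k, q (J k)) * t J) ^ (1 - (1 + s)⁻¹) *
        (∑ J : Fin n → ι, (∏ k, q (J k)) * t J * (∏ k, ρ (J k)) ^ (1 + s)) ^ (1 + s)⁻¹) ^ (1 + s) :=
        Real.rpow_le_rpow (Finset.sum_nonneg fun J _ =>
          mul_nonneg (mul_nonneg (hqJ J) (ht0 J)) (hρJ J)) hH h1s.le
    _ = (∑ J : Fin n → ι, (∏ k, q (J k)) * t J) ^ s *
        ∑ J : Fin n → ι, (∏ k, q (J k)) * t J * (∏ k, ρ (J k)) ^ (1 + s) := by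
        rw [Real.mul_rpow (Real.rpow_nonneg hG0 _) (Real.rpow_nonneg hA _), ← Real.rpow_mul hG0,
          ← Real.rpow_mul hA, inv_mul_cancel₀ h1s.ne', Real.rpow_one, sub_mul,
          inv_mul_cancel₀ h1s.ne']
        ring_nf
    _ ≤ _ := mul_le_mul (Real.rpow_le_rpow hG0 hG hs.le) hmom hA (Real.rpow_nonneg (hG0.trans hG) _)

end converse

lemma IsSeparableSuperoperator.fidelity_bellDiagonal_half_le {n K : ℕ}
    {P : Matrix ((Fin n → Fin 2) × (Fin n → Fin 2)) ((Fin n → Fin 2) × (Fin n → Fin 2)) ℂ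
      →ₗ[ℂ] Matrix (Fin K × Fin K) (Fin K × Fin K) ℂ} (hP : IsSeparableSuperoperator P)
    (q : Fin 4 → ℝ) (σ : Equiv.Perm (Fin 4))
    (hq : ∀ k, 0 ≤ q k) (hq0 : q 0 = 1 / 2) (hsum : ∑ k, q k = 1) :
    fidelity (P (tensorPower (bellDiagonal q σ) n)) ≤ 1 / (K : ℝ) := by
  obtain ⟨p, a, b, hp, hp1, ha, hb, h⟩ := bellDiagonal_eq_product_mixture q σ hq hq0 hsum
  rw [h]
  simpa using hP.fidelity_le_one_div_card p hp hp1 a b ha hb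

lemma isSeparableState_bellDiagonal_half (q : Fin 4 → ℝ) (σ : Equiv.Perm (Fin 4))
    (hq : ∀ k, 0 ≤ q k) (hq0 : q 0 = 1 / 2) (hsum : ∑ k, q k = 1) :
    IsSeparableState (bellDiagonal q σ) := by
  obtain ⟨p, a, b, hp, hp1, ha, hb, h⟩ := bellDiagonal_eq_product_mixture q σ hq hq0 hsum
  rw [h]
  exact isSeparableState_mixture p hp hp1 a b ha hb

lemma comparisonEigenvalues_spec {β : Fin 4 → ℝ} (hnonneg : ∀ k, 0 ≤ β k) (hsum : ∑ k, β k = 1)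
    (h1 : β 0 < 1) :
    (∀ k, 0 ≤ comparisonEigenvalues β k) ∧ ∑ k, comparisonEigenvalues β k = 1 := by
  have hpos : 0 < 2 - 2 * β 0 := by linarith
  constructor
  · intro k
    fin_cases k <;> simp [comparisonEigenvalues] <;>
      exact div_nonneg (hnonneg _) hpos.le
  · rw [Fin.sum_univ_four] at hsum ⊢
    simp only [comparisonEigenvalues, Matrix.cons_val]
    rw [add_assoc, add_assoc, ← add_div, ← add_div,
      show β 1 + (β 2 + β 3) = 1 / 2 * (2 - 2 * β 0) by linarith, mul_div_cancel_right₀ _ hpos.ne']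
    norm_num

/-- Eigenvalues of a separable Bell-diagonal state dominating those of `β`, with the
likelihood ratio taking the values `2 β₀` and `2 (1 - β₀)`. -/
lemma exists_reference_eigenvalues {β : Fin 4 → ℝ} (hnonneg : ∀ k, 0 ≤ β k)
    (hsum : ∑ k, β k = 1) :
    ∃ q : Fin 4 → ℝ, (∀ k, 0 ≤ q k) ∧ q 0 = 1 / 2 ∧ ∑ k, q k = 1 ∧
      ∀ k, β k = q k * (if k = 0 then 2 * β 0 else 2 * (1 - β 0)) := by
  have hle : β 0 ≤ 1 := hsum ▸ Finset.single_le_sum (fun k _ => hnonneg k) (Finset.mem_univ 0)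
  rcases hle.lt_or_eq with h1 | h1
  · obtain ⟨h2, h3⟩ := comparisonEigenvalues_spec hnonneg hsum h1
    refine ⟨_, h2, rfl, h3, fun k => ?_⟩
    have hne : 2 - 2 * β 0 ≠ 0 := by linarith
    fin_cases k <;> simp [comparisonEigenvalues] <;> field_simp
  -- At β₀ = 1 the comparison eigenvalues are undefined. Any completion of `q 0 = 1/2` works, since
  -- the other ratios 2(1 - β₀) and the other β vanish.
  · refine ⟨![1 / 2, 1 / 2, 0, 0], ?_, rfl, ?_, ?_⟩
    · intro k
      fin_cases k <;> simp
    · rw [Fin.sum_univ_four]; simp; norm_num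
    · rw [Fin.sum_univ_four] at hsum
      have e1 := hnonneg 1
      have e2 := hnonneg 2
      have e3 := hnonneg 3
      intro k
      fin_cases k <;> simp [h1] <;> linarith

/-- Above the hashing rate the squared fidelity is exponentially small, uniformly in the number
of copies. -/
lemma exists_fidelity_sq_le_pow {β : Fin 4 → ℝ} (σ : Equiv.Perm (Fin 4)) (hnonneg : ∀ k, 0 ≤ β k)
    (hsum : ∑ k, β k = 1) {R : ℝ} (hR : 1 - H₂ (β 0) < R) :
    ∃ c : ℝ, 0 ≤ c ∧ c < 1 ∧ ∀ (n K : ℕ)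
      (P : Matrix ((Fin n → Fin 2) × (Fin n → Fin 2)) ((Fin n → Fin 2) × (Fin n → Fin 2)) ℂ
        →ₗ[ℂ] Matrix (Fin K × Fin K) (Fin K × Fin K) ℂ), IsSeparableSuperoperator P → 0 < K →
      (n : ℝ) * R ≤ Real.logb 2 K →
      fidelity (P (tensorPower (bellDiagonal β σ) n)) ^ 2 ≤ c ^ n := by
  obtain ⟨q, hq, hq0, hq1, hβ⟩ := exists_reference_eigenvalues hnonneg hsum
  set ρ : Fin 4 → ℝ := fun k => if k = 0 then 2 * β 0 else 2 * (1 - β 0) with hρdef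
  have hle : β 0 ≤ 1 := hsum ▸ Finset.single_le_sum (fun k _ => hnonneg k) (Finset.mem_univ 0)
  have hρ : ∀ k, 0 ≤ ρ k := by
    intro k
    have := hnonneg 0
    simp only [hρdef]
    split_ifs <;> linarith
  have hl2 : 0 < Real.log 2 := Real.log_pos (by norm_num)
  -- The mean log-likelihood ratio is the relative entropy of β to q, namely (1 - H₂(β₀)) log 2. The
  -- convention log 0 = 0 covers the degenerate cases.
  have hmean : ∑ k, β k * Real.log (ρ k) < R * Real.log 2 := by
    have h1 : ∑ k : Fin 3, β k.succ = 1 - β 0 := by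
      rw [Fin.sum_univ_succ] at hsum; linarith
    have h2 : ∑ k, β k * Real.log (ρ k) =
        β 0 * Real.log (2 * β 0) + (1 - β 0) * Real.log (2 * (1 - β 0)) := by
      rw [Fin.sum_univ_succ]
      simp only [hρdef, if_true, Fin.succ_ne_zero, if_false]
      rw [← Finset.sum_mul, h1]
    have h3 : ∀ x : ℝ, x * Real.log (2 * x) = x * Real.log 2 + x * Real.log x := by
      intro x
      rcases eq_or_ne x 0 with rfl | hx
      · simp
      · rw [Real.log_mul two_ne_zero hx, mul_add]
    rw [h2, h3, h3]
    have h4 : (1 - H₂ (β 0)) * Real.log 2 < R * Real.log 2 := mul_lt_mul_of_pos_right hR hl2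
    rw [H₂, Real.binEntropy, sub_mul, div_mul_cancel₀ _ hl2.ne', Real.log_inv, Real.log_inv] at h4
    linarith
  obtain ⟨s, hs0, hs1, hs⟩ := exists_exp_moment_lt_one β (fun k => Real.log (ρ k)) hsum hmean
  refine ⟨_, Finset.sum_nonneg fun k _ => mul_nonneg (hnonneg k) (Real.exp_pos _).le, hs,
    fun n K P hP hK hKR => ?_⟩
  have hbell : bellDiagonal β σ = ∑ k, ((q k * ρ k : ℝ) : ℂ) • pureState (bellVec (σ k)) := by
    rw [bellDiagonal_eq]
    exact Finset.sum_congr rfl fun k _ => by rw [hβ k]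
  have hF := hP.fidelity_rpow_le q ρ hq hρ (fun k => bellVec (σ k)) (fun k => sqNorm_bellVec _) hs0
    (hP.fidelity_bellDiagonal_half_le q σ hq hq0 hq1)
  rw [← hbell] at hF
  obtain ⟨hF0, hF1⟩ := hP.fidelity_mixture_mem_Icc β hnonneg hsum (fun k => bellVec (σ k))
    (fun k => sqNorm_bellVec _)
  rw [← bellDiagonal_eq] at hF0 hF1
  have hK' : (0 : ℝ) < K := Nat.cast_pos.2 hK
  have hKs : (1 / (K : ℝ)) ^ s ≤ Real.exp (-(s * (R * Real.log 2))) ^ n := by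
    rw [← Real.exp_nat_mul, Real.rpow_def_of_pos (by positivity), Real.exp_le_exp, one_div,
      Real.log_inv]
    rw [Real.logb, le_div_iff₀ hl2] at hKR
    nlinarith
  -- Absorbing the rate factor turns the q-moment of order 1 + s into the β-moment of order s. If ρ
  -- vanishes, so does β.
  have hexp : ∀ k, Real.exp (-(s * (R * Real.log 2))) * (q k * ρ k ^ (1 + s)) =
      β k * Real.exp (s * (Real.log (ρ k) - R * Real.log 2)) := by
    intro k
    rcases (hρ k).eq_or_lt with h | h
    · rw [hβ k, show (if k = 0 then 2 * β 0 else 2 * (1 - β 0)) = ρ k from rfl, ← h,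
        Real.zero_rpow (by linarith)]
      simp
    · rw [hβ k, show (if k = 0 then 2 * β 0 else 2 * (1 - β 0)) = ρ k from rfl,
        Real.rpow_add h, Real.rpow_one, Real.rpow_def_of_pos h,
        show s * (Real.log (ρ k) - R * Real.log 2) =
          -(s * (R * Real.log 2)) + Real.log (ρ k) * s by ring, Real.exp_add]
      ring
  -- As F lies in [0, 1] and s ≤ 1, F² ≤ F^(1+s); the exponent 2 frees the conclusion from s.
  calc fidelity (P (tensorPower (bellDiagonal β σ) n)) ^ 2
      ≤ fidelity (P (tensorPower (bellDiagonal β σ) n)) ^ (1 + s) := by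
        rw [← Real.rpow_natCast]
        exact Real.rpow_le_rpow_of_exponent_ge' hF0 hF1 (by linarith) (by push_cast; linarith)
    _ ≤ _ := hF
    _ ≤ Real.exp (-(s * (R * Real.log 2))) ^ n * (∑ j, q j * ρ j ^ (1 + s)) ^ n := by
        refine mul_le_mul_of_nonneg_right hKs (pow_nonneg (Finset.sum_nonneg fun j _ =>
          mul_nonneg (hq j) (Real.rpow_nonneg (hρ j) _)) _)
    _ = _ := by
        rw [← mul_pow, Finset.mul_sum]
        simp only [hexp]

/-! ### One-way protocols and hashing -/

/-- The superoperator with Kraus operators `C i`. -/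
noncomputable def krausMap {κ α β : Type*} [Fintype κ] [Fintype α] [Fintype β]
    (C : κ → Matrix β α ℂ) : Matrix α α ℂ →ₗ[ℂ] Matrix β β ℂ where
  toFun ρ := ∑ i, C i * ρ * (C i)ᴴ
  map_add' ρ τ := by simp only [Matrix.mul_add, Matrix.add_mul,
    Finset.sum_add_distrib]
  map_smul' c ρ := by simp only [Matrix.mul_smul, Matrix.smul_mul, Finset.smul_sum,
    RingHom.id_apply]

section oneWay

variable {S T v₁ v₂ w : Type*} [Fintype S] [Fintype T] [Fintype v₁] [Fintype v₂] [Fintype w]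
  [DecidableEq v₁] [DecidableEq v₂]

/-- A local measurement followed by a measurement on the other side which depends on the outcome
is a separable superoperator. -/
lemma isSeparableSuperoperator_oneWay (A : S → Matrix w v₁ ℂ) (B : S → T → Matrix w v₂ ℂ)
    (hA : ∑ s, (A s)ᴴ * A s = 1) (hB : ∀ s, ∑ t, (B s t)ᴴ * B s t = 1) :
    IsSeparableSuperoperator (krausMap fun i : S × T => A i.1 ⊗ₖ B i.1 i.2) := by
  let f := (Fintype.equivFin (S × T)).symm
  refine ⟨Fintype.card (S × T), fun i => A (f i).1, fun i => B (f i).1 (f i).2, fun ρ => ?_, ?_⟩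
  · exact (f.sum_comp fun i : S × T => (A i.1 ⊗ₖ B i.1 i.2) * ρ * (A i.1 ⊗ₖ B i.1 i.2)ᴴ).symm
  · rw [f.sum_comp fun i : S × T => (A i.1 ⊗ₖ B i.1 i.2)ᴴ * (A i.1 ⊗ₖ B i.1 i.2),
      Fintype.sum_prod_type]
    have h : ∀ s, ∑ t, (A s ⊗ₖ B s t)ᴴ * (A s ⊗ₖ B s t) = ((A s)ᴴ * A s) ⊗ₖ (1 : Matrix v₂ v₂ ℂ) := by
      intro s
      rw [← hB s]
      ext x y
      simp only [Matrix.conjTranspose_kronecker, ← Matrix.mul_kronecker_mul, Matrix.sum_apply,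
        Matrix.kroneckerMap_apply, Finset.mul_sum]
    simp only [h]
    rw [← Matrix.one_kronecker_one, ← hA]
    ext x y
    simp only [Matrix.sum_apply, Matrix.kroneckerMap_apply, Finset.sum_mul]

end oneWay

/-- The operator mapping the basis vector `f k` to the basis vector `k`, for all `k`. -/
noncomputable def relabel {κ α : Type*} [DecidableEq α] (f : κ → α) : Matrix κ α ℂ :=
  Matrix.of fun k x => if x = f k then 1 else 0

/-- Bijectivity says that the images of the `f s` partition the basis, so these are the coordinate
projectors of a complete measurement. -/
lemma sum_relabel_conjTranspose_mul {S κ α : Type*} [Fintype S] [Fintype κ] [DecidableEq α]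
    (f : S → κ → α) (hf : Function.Bijective fun i : S × κ => f i.1 i.2) :
    ∑ s, (relabel (f s))ᴴ * relabel (f s) = 1 := by
  ext x y
  have h : ∑ i : S × κ, (if x = f i.1 i.2 then (1 : ℂ) else 0) * (if y = f i.1 i.2 then 1 else 0) =
      (1 : Matrix α α ℂ) x y := by
    obtain ⟨i, hi⟩ := hf.2 x
    rw [Finset.sum_eq_single i]
    · simp only at hi
      rw [hi, if_pos rfl, one_mul, Matrix.one_apply]
      simp only [eq_comm]
    · intro j _ hj
      rw [if_neg, zero_mul]
      rintro h
      exact hj (hf.1 (h.symm.trans hi.symm))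
    · simp
  rw [← h, Fintype.sum_prod_type, Matrix.sum_apply]
  refine Finset.sum_congr rfl fun s _ => ?_
  simp [Matrix.mul_apply, relabel, apply_ite]

lemma relabel_kronecker_mulVec {κ α β : Type*} [Fintype α] [Fintype β] [DecidableEq α]
    [DecidableEq β] (f : κ → α) (g : κ → β) (u : α × β → ℂ) (x : κ × κ) :
    ((relabel f ⊗ₖ relabel g) *ᵥ u) x = u (f x.1, g x.2) := by
  simp only [Matrix.mulVec, dotProduct, Fintype.sum_prod_type, Matrix.kroneckerMap_apply, relabel,
    Matrix.of_apply]
  rw [Finset.sum_eq_single (f x.1), Finset.sum_eq_single (g x.2)]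
  · simp
  · intro y _ hy
    simp [hy]
  · simp
  · intro y _ hy
    simp [hy]
  · simp

/-- Hashing with a linear code `C` and coset leaders `d`, preceded by local isometries. -/
lemma exists_hashing_superoperator {G : Type*} [AddCommGroup G] [Fintype G] [DecidableEq G]
    (C : AddSubgroup G) (d : G ⧸ C → G) (hd : ∀ t, (d t : G ⧸ C) = t) {K : ℕ}
    (hK : Nat.card C = K) (U V : Matrix G G ℂ) (hU : Uᴴ * U = 1) (hV : Vᴴ * V = 1) :
    ∃ P : Matrix (G × G) (G × G) ℂ →ₗ[ℂ] Matrix (Fin K × Fin K) (Fin K × Fin K) ℂ,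
      IsSeparableSuperoperator P ∧ ∀ (e : G) (u : G × G → ℂ) (c : ℂ), d e = e →
        ‖c‖ ^ 2 = 1 / (Fintype.card G : ℝ) →
        (U ⊗ₖ V) *ᵥ u = (fun x => if x.2 = x.1 + e then c else 0) →
        1 ≤ fidelity (P (pureState u)) := by
  classical
  have : Fintype (G ⧸ C) := Fintype.ofFinite _
  obtain ⟨κ⟩ : Nonempty (Fin K ≃ C) := ⟨(Finite.equivFinOfCardEq hK).symm⟩
  have hK0 : (0 : ℝ) < K := by
    rw [← hK]; exact_mod_cast Nat.card_pos
  have hout : ∀ t : G ⧸ C, ((Quotient.out t : G) : G ⧸ C) = t := fun t => Quotient.out_eq' t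
  have hmk : ∀ k, ((κ k : G) : G ⧸ C) = 0 := fun k => (QuotientAddGroup.eq_zero_iff _).2 (κ k).2
  have bij : ∀ r : G ⧸ C → G, (∃ s, ∀ t, (r t : G ⧸ C) = s + t) →
      Function.Bijective fun i : (G ⧸ C) × Fin K => r i.1 + κ i.2 := by
    rintro r ⟨s, hr⟩
    constructor
    · rintro ⟨t, k⟩ ⟨t', k'⟩ h
      simp only at h
      have h1 := congrArg (fun x : G => (x : G ⧸ C)) h
      simp only [QuotientAddGroup.mk_add, hr, hmk, add_zero, add_right_inj] at h1
      subst h1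
      rw [add_right_inj] at h
      rw [κ.injective (Subtype.ext h)]
    · intro x
      have hx : x - r ((x : G ⧸ C) - s) ∈ C := by
        rw [← QuotientAddGroup.eq_zero_iff, QuotientAddGroup.mk_sub, hr]
        abel
      refine ⟨((x : G ⧸ C) - s, κ.symm ⟨_, hx⟩), ?_⟩
      simp
  -- The first party measures its coset s of C. The second measures its coset relative to s; outcome
  -- t is the syndrome of the error, undone by subtracting the leader `d t`.
  set f : G ⧸ C → Fin K → G := fun s k => Quotient.out s + κ k with hf
  set g : G ⧸ C → G ⧸ C → Fin K → G := fun s t k => Quotient.out s + d t + κ k with hg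
  have hbf := bij (fun s => Quotient.out s) ⟨0, fun t => by rw [hout, zero_add]⟩
  have hbg := fun s => bij (fun t => Quotient.out s + d t) ⟨s, fun t => by
    rw [QuotientAddGroup.mk_add, hout, hd]⟩
  have hA : ∑ s, (relabel (f s) * U)ᴴ * (relabel (f s) * U) = 1 := by
    simp only [Matrix.conjTranspose_mul, Matrix.mul_assoc]
    simp only [← Matrix.mul_assoc (relabel _)ᴴ]
    rw [← Matrix.mul_sum, ← Matrix.sum_mul, sum_relabel_conjTranspose_mul f hbf, Matrix.one_mul, hU]
  have hB : ∀ s, ∑ t, (relabel (g s t) * V)ᴴ * (relabel (g s t) * V) = 1 := by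
    intro s
    simp only [Matrix.conjTranspose_mul, Matrix.mul_assoc]
    simp only [← Matrix.mul_assoc (relabel _)ᴴ]
    rw [← Matrix.mul_sum, ← Matrix.sum_mul, sum_relabel_conjTranspose_mul (g s) (hbg s),
      Matrix.one_mul, hV]
  refine ⟨_, isSeparableSuperoperator_oneWay _ _ hA hB, fun e u c he hc hu => ?_⟩
  have hcard : (Fintype.card (G ⧸ C) : ℝ) * K = Fintype.card G := by
    have h := Fintype.card_of_bijective hbf
    rw [Fintype.card_prod, Fintype.card_fin] at h
    exact_mod_cast h
  -- With the correct syndrome both labels agree, so the amplitude is K c / √K, and its square is K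
  -- / |G|.
  have hterm : ∀ s : G ⧸ C, ‖star (maxEntangled (Fin K)) ⬝ᵥ
      (((relabel (f s) * U) ⊗ₖ (relabel (g s e) * V)) *ᵥ u)‖ ^ 2 = K / (Fintype.card G : ℝ) := by
    intro s
    rw [Matrix.mul_kronecker_mul, ← Matrix.mulVec_mulVec, hu, star_maxEntangled_dotProduct]
    simp only [relabel_kronecker_mulVec]
    have h : ∀ k, g s e k = f s k + e := by
      intro k
      simp only [hf, hg, he]
      abel
    simp only [h, if_true, Finset.sum_const, Finset.card_univ, Fintype.card_fin, nsmul_eq_mul]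
    rw [norm_mul, norm_mul, mul_pow, mul_pow, hc, Complex.norm_real, Real.norm_eq_abs, sq_abs,
      div_pow, Real.sq_sqrt (Nat.cast_nonneg _), Complex.norm_natCast]
    field_simp
  have hG : (0 : ℝ) < Fintype.card G := by exact_mod_cast Fintype.card_pos
  calc (1 : ℝ) = ∑ s : G ⧸ C, (K / (Fintype.card G : ℝ)) := by
        rw [Finset.sum_const, Finset.card_univ, nsmul_eq_mul, ← mul_div_assoc, hcard,
          div_self hG.ne']
    -- Keeping only the correct syndrome loses nothing: the |G| / K cosets s already give total
    -- fidelity 1.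
    _ ≤ ∑ s : G ⧸ C, ∑ t : G ⧸ C, ‖star (maxEntangled (Fin K)) ⬝ᵥ
      (((relabel (f s) * U) ⊗ₖ (relabel (g s t) * V)) *ᵥ u)‖ ^ 2 := by
        refine Finset.sum_le_sum fun s _ => ?_
        rw [← hterm s]
        exact Finset.single_le_sum (f := fun t => ‖star (maxEntangled (Fin K)) ⬝ᵥ
          (((relabel (f s) * U) ⊗ₖ (relabel (g s t) * V)) *ᵥ u)‖ ^ 2)
          (fun t _ => sq_nonneg _) (Finset.mem_univ (e : G ⧸ C))
    _ = _ := by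
        rw [← Fintype.sum_prod_type']
        simp only [krausMap, LinearMap.coe_mk, AddHom.coe_mk, fidelity_sum, fidelity_conj]

/-! ### Random linear codes -/

/-- A random linear code of dimension `k` separates the elements of a set `T` up to a fraction
`|T| 2 ^ (k - n)` of the total weight. -/
lemma exists_linear_code {n k : ℕ} (hn : n ≠ 0) (hk : k ≤ n) (T : Finset (Fin n → Fin 2))
    (p : (Fin n → Fin 2) → ℝ) (hp : ∀ e, 0 ≤ p e) :
    ∃ C : AddSubgroup (Fin n → Fin 2), Nat.card C = 2 ^ k ∧
      ∀ B ⊆ T, (∀ e ∈ B, ∃ e' ∈ T, e' ≠ e ∧ e - e' ∈ C) →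
        ∑ e ∈ B, p e ≤ (T.card : ℝ) * 2 ^ k / 2 ^ n * ∑ e, p e := by
  classical
  have : Fact (Nat.Prime 2) := ⟨Nat.prime_two⟩
  let F := GaloisField 2 n
  have : Fintype F := Fintype.ofFinite F
  have hF : Nat.card F = 2 ^ n := GaloisField.card 2 n hn
  let b : Module.Basis (Fin n) (ZMod 2) F := Module.finBasisOfFinrankEq _ _ (GaloisField.finrank 2 hn)
  let ψ : (Fin n → Fin 2) ≃+ F :=
    (AddEquiv.piCongrRight fun _ => (ZMod.finEquiv 2).toAddEquiv).trans b.equivFun.symm.toAddEquiv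
  obtain ⟨C₀', hC₀'⟩ := Sylow.exists_subgroup_card_pow_prime (G := Multiplicative F) 2 (n := k)
    (by rw [show Nat.card (Multiplicative F) = 2 ^ n from hF]; exact pow_dvd_pow 2 hk)
  let C₀ : AddSubgroup F := Subgroup.toAddSubgroup' C₀'
  have hC₀ : Nat.card C₀ = 2 ^ k := hC₀'
  -- The random family consists of the multiples a⁻¹ C₀ of one additive subgroup of the field with
  -- 2^n elements. For x ≠ 0 the map a ↦ a x is injective into the nonzero elements, so at most 2^k
  -- - 1 of the 2^n - 1 codes contain x.
  let C : Fˣ → AddSubgroup (Fin n → Fin 2) := fun a =>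
    C₀.comap ((AddMonoidHom.mulLeft (a : F)).comp ψ.toAddMonoidHom)
  have hmem : ∀ a x, x ∈ C a ↔ (a : F) * ψ x ∈ C₀ := fun a x => Iff.rfl
  have hcard : ∀ a, Nat.card (C a) = 2 ^ k := by
    intro a
    rw [← hC₀]
    exact Nat.card_congr ((ψ.toEquiv.trans (Units.mulLeft a)).subtypeEquiv fun x => hmem a x)
  have hcount : ∀ x : F, x ≠ 0 →
      ((Finset.univ.filter fun a : Fˣ => (a : F) * x ∈ C₀).card : ℝ) ≤ 2 ^ k - 1 := by
    intro x hx
    have h1 : (Finset.univ.filter fun a : Fˣ => (a : F) * x ∈ C₀).card ≤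
        ((Finset.univ.filter fun y : F => y ∈ C₀).erase 0).card := by
      refine Finset.card_le_card_of_injOn (fun a => (a : F) * x) (fun a ha => ?_) ?_
      · have ha' := (Finset.mem_filter.1 ha).2
        simpa [hx] using ha'
      · intro a _ a' _ h
        exact Units.ext (mul_right_cancel₀ hx h)
    have h2 : (Finset.univ.filter fun y : F => y ∈ C₀).card = 2 ^ k := by
      rw [← hC₀, Nat.card_eq_fintype_card, Fintype.card_subtype]
    rw [Finset.card_erase_of_mem (by simp [C₀.zero_mem]), h2] at h1
    have h3 : 1 ≤ 2 ^ k := Nat.one_le_two_pow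
    calc ((Finset.univ.filter fun a : Fˣ => (a : F) * x ∈ C₀).card : ℝ)
        ≤ ((2 ^ k - 1 : ℕ) : ℝ) := by exact_mod_cast h1
      _ = 2 ^ k - 1 := by push_cast [Nat.cast_sub h3]; rfl
  have hunits : (Fintype.card Fˣ : ℝ) = 2 ^ n - 1 := by
    have h3 : 1 ≤ 2 ^ n := Nat.one_le_two_pow
    rw [Fintype.card_units, ← Nat.card_eq_fintype_card, hF]
    push_cast [Nat.cast_sub h3]; rfl
  have hS : 0 ≤ ∑ e, p e := Finset.sum_nonneg fun e _ => hp e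
  have hTS : 0 ≤ (T.card : ℝ) * ∑ e, p e := mul_nonneg (Nat.cast_nonneg _) hS
  have hpow : (2 : ℝ) ^ k - 1 ≤ (2 ^ n - 1) * (2 ^ k / 2 ^ n) := by
    have h : (2 : ℝ) ^ k ≤ 2 ^ n := pow_le_pow_right₀ one_le_two hk
    have h' : (2 : ℝ) ^ k / 2 ^ n ≤ 1 := (div_le_one (by positivity)).2 h
    rw [sub_mul, mul_div_cancel₀ _ (by positivity)]
    linarith
  -- First-moment bound: average over a of the weight of ordered pairs in T which the code cannot
  -- distinguish.
  have havg : ∑ a : Fˣ, ∑ e ∈ T, ∑ e' ∈ T.erase e, (if e - e' ∈ C a then p e else 0) ≤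
      ∑ _a : Fˣ, (T.card : ℝ) * 2 ^ k / 2 ^ n * ∑ e, p e := by
    have hpair : ∀ e, ∀ e' ∈ T.erase e,
        ∑ a : Fˣ, (if e - e' ∈ C a then p e else 0) ≤ (2 ^ k - 1) * p e := by
      intro e e' he'
      rw [← Finset.sum_filter, Finset.sum_const, nsmul_eq_mul]
      refine mul_le_mul_of_nonneg_right (hcount (ψ (e - e')) ?_) (hp e)
      rw [Ne, EmbeddingLike.map_eq_zero_iff, sub_eq_zero]
      exact (Finset.ne_of_mem_erase he').symm
    have hk1 : (0 : ℝ) ≤ 2 ^ k - 1 := by linarith [one_le_pow₀ (M₀ := ℝ) one_le_two (n := k)]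
    calc _ = ∑ e ∈ T, ∑ e' ∈ T.erase e, ∑ a : Fˣ, (if e - e' ∈ C a then p e else 0) := by
          rw [Finset.sum_comm]
          exact Finset.sum_congr rfl fun e _ => Finset.sum_comm
      _ ≤ ∑ e ∈ T, ∑ e' ∈ T.erase e, (2 ^ k - 1) * p e :=
          Finset.sum_le_sum fun e _ => Finset.sum_le_sum fun e' he' => hpair e e' he'
      _ ≤ ∑ e ∈ T, (T.card : ℝ) * ((2 ^ k - 1) * p e) := by
          refine Finset.sum_le_sum fun e _ => ?_
          rw [Finset.sum_const, nsmul_eq_mul]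
          refine mul_le_mul_of_nonneg_right ?_ (mul_nonneg hk1 (hp e))
          exact_mod_cast Finset.card_erase_le
      _ ≤ ∑ e, (T.card : ℝ) * ((2 ^ k - 1) * p e) :=
          Finset.sum_le_univ_sum_of_nonneg fun e =>
            mul_nonneg (Nat.cast_nonneg _) (mul_nonneg hk1 (hp e))
      _ = (2 ^ k - 1) * (T.card * ∑ e, p e) := by
          rw [Finset.mul_sum, Finset.mul_sum]
          exact Finset.sum_congr rfl fun e _ => by ring
      _ ≤ (2 ^ n - 1) * (2 ^ k / 2 ^ n) * (T.card * ∑ e, p e) :=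
          mul_le_mul_of_nonneg_right hpow hTS
      _ = _ := by
          rw [Finset.sum_const, Finset.card_univ, nsmul_eq_mul, hunits]
          ring
  obtain ⟨a, -, ha⟩ := Finset.exists_le_of_sum_le (Finset.univ_nonempty (α := Fˣ)) havg
  refine ⟨C a, hcard a, fun B hB hBT => le_trans ?_ ha⟩
  have hnn : ∀ e e', 0 ≤ if e - e' ∈ C a then p e else 0 := fun e e' => by
    split_ifs
    exacts [hp e, le_rfl]
  -- Each element of B has at least one confusable partner, so its weight is counted at least once.
  calc ∑ e ∈ B, p e ≤ ∑ e ∈ B, ∑ e' ∈ T.erase e, (if e - e' ∈ C a then p e else 0) := by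
        refine Finset.sum_le_sum fun e he => ?_
        obtain ⟨e', he', hne, hC⟩ := hBT e he
        refine le_trans (le_of_eq (if_pos hC).symm) (Finset.single_le_sum
          (f := fun e' => if e - e' ∈ C a then p e else 0) (fun e' _ => hnn e e')
          (Finset.mem_erase.2 ⟨hne, he'⟩))
    _ ≤ _ := Finset.sum_le_sum_of_subset_of_nonneg hB fun e _ _ =>
        Finset.sum_nonneg fun e' _ => hnn e e'

/-! ### Two Bell states as a bit-flip error -/

/-- The `n`-fold tensor power of an operator. -/
noncomputable def matPow {v : Type*} (U : Matrix v v ℂ) (n : ℕ) :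
    Matrix (Fin n → v) (Fin n → v) ℂ := Matrix.of fun x y => ∏ k, U (x k) (y k)

section matPow

variable {v : Type*} [Fintype v] [DecidableEq v]

lemma matPow_conjTranspose_mul_self {U : Matrix v v ℂ} (hU : Uᴴ * U = 1) (n : ℕ) :
    (matPow U n)ᴴ * matPow U n = 1 := by
  ext x y
  have h : ∀ i j, ∑ z, star (U z i) * U z j = (1 : Matrix v v ℂ) i j := fun i j => by
    rw [← hU]; rfl
  simp only [Matrix.mul_apply, Matrix.conjTranspose_apply, matPow, Matrix.of_apply, star_prod,
    ← Finset.prod_mul_distrib]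
  rw [← Fintype.piFinset_univ, ← Finset.prod_univ_sum (fun _ => Finset.univ)
    (fun k z => star (U z (x k)) * U z (y k))]
  simp only [h, Matrix.one_apply]
  rw [Finset.prod_ite_zero]
  simp [funext_iff]

end matPow

lemma matPow_kronecker_mulVec_vecPow {ι v : Type*} [Fintype v] (U V : Matrix v v ℂ)
    (b : ι → v × v → ℂ) {n : ℕ} (J : Fin n → ι) :
    (matPow U n ⊗ₖ matPow V n) *ᵥ vecPow b J = vecPow (fun j => (U ⊗ₖ V) *ᵥ b j) J := by
  ext x
  simp only [Matrix.mulVec, dotProduct, vecPow, Matrix.kroneckerMap_apply, matPow,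
    Matrix.of_apply, ← Finset.prod_mul_distrib]
  rw [Finset.prod_univ_sum, Fintype.piFinset_univ]
  exact (Equiv.sum_comp (Equiv.arrowProdEquivProdArrow (Fin n) (fun _ => v) (fun _ => v))
    (fun y => ∏ k, U (x.1 k) (y.1 k) * V (x.2 k) (y.2 k) * b (J k) (y.1 k, y.2 k))).symm

/-- The matrices with entries `√2 ⟨x, y | b_k⟩`. -/
def bellMat (k : Fin 4) : Matrix (Fin 2) (Fin 2) ℂ :=
  ![!![1, 0; 0, 1], !![1, 0; 0, -1], !![0, 1; 1, 0], !![0, 1; -1, 0]] k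

/-- A vector in the tensor product is a matrix M, on which U ⊗ V acts as U M Vᵀ; this reduces local
equivalence of Bell states to 2 × 2 matrix algebra. -/
lemma kronecker_mulVec_bellVec (U V : Matrix (Fin 2) (Fin 2) ℂ) (k : Fin 4) (x : Fin 2 × Fin 2) :
    ((U ⊗ₖ V) *ᵥ bellVec k) x = invSqrtTwo * (U * bellMat k * Vᵀ) x.1 x.2 := by
  obtain ⟨x, y⟩ := x
  simp only [Matrix.mulVec, dotProduct, Fintype.sum_prod_type, Matrix.kroneckerMap_apply,
    bellVec_apply, Matrix.mul_apply, Matrix.transpose_apply, Fin.sum_univ_two, bellMat]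
  ring

lemma bellMat_mul_conjTranspose (k : Fin 4) : bellMat k * (bellMat k)ᴴ = 1 := by
  ext x y
  fin_cases k <;> fin_cases x <;> fin_cases y <;>
    simp [bellMat, Matrix.mul_apply, Fin.sum_univ_two]

/-- Relative to one Bell state, any other one is a bit flip in a suitable basis. -/
lemma exists_unitary_conj_bellMat {i j : Fin 4} (hij : i ≠ j) :
    ∃ (W : Matrix (Fin 2) (Fin 2) ℂ) (c : ℂ), Wᴴ * W = 1 ∧ ‖c‖ = 1 ∧
      W * ((bellMat i)ᴴ * bellMat j) * Wᴴ = c • !![0, 1; 1, 0] := by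
  have hs := invSqrtTwo_mul_self
  have hH : !![invSqrtTwo, invSqrtTwo; invSqrtTwo, -invSqrtTwo]ᴴ *
      !![invSqrtTwo, invSqrtTwo; invSqrtTwo, -invSqrtTwo] = 1 := by
    ext x y
    fin_cases x <;> fin_cases y <;>
      simp [Matrix.mul_apply, Fin.sum_univ_two, conj_invSqrtTwo] <;> grind
  have hI : !![1, 0; 0, Complex.I]ᴴ * !![1, 0; 0, Complex.I] = 1 := by
    ext x y
    fin_cases x <;> fin_cases y <;> simp [Matrix.mul_apply, Fin.sum_univ_two]
  -- Up to sign the relative operator is Z, X or iY. The Hadamard matrix conjugates Z to X, and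
  -- diag(1, i) conjugates iY to a phase times X.
  have key : (bellMat i)ᴴ * bellMat j = !![1, 0; 0, -1] ∨ (bellMat i)ᴴ * bellMat j = !![-1, 0; 0, 1] ∨
      (bellMat i)ᴴ * bellMat j = !![0, 1; 1, 0] ∨ (bellMat i)ᴴ * bellMat j = !![0, -1; -1, 0] ∨
      (bellMat i)ᴴ * bellMat j = !![0, 1; -1, 0] ∨ (bellMat i)ᴴ * bellMat j = !![0, -1; 1, 0] := by
    simp only [← Matrix.ext_iff, Fin.forall_fin_two]
    fin_cases i <;> fin_cases j <;> first | exact absurd rfl hij |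
      norm_num [bellMat, Matrix.mul_apply, Fin.sum_univ_two, eq_neg_iff_add_eq_zero]
  have hc : ∀ W M : Matrix (Fin 2) (Fin 2) ℂ, ∀ c : ℂ, (∀ x y, (W * M * Wᴴ) x y =
      (c • !![0, 1; 1, 0] : Matrix (Fin 2) (Fin 2) ℂ) x y) → W * M * Wᴴ = c • !![0, 1; 1, 0] :=
    fun W M c h => Matrix.ext h
  rcases key with h | h | h | h | h | h <;> rw [h]
  · refine ⟨_, 1, hH, by simp, hc _ _ _ fun x y => ?_⟩
    fin_cases x <;> fin_cases y <;>
      simp [Matrix.mul_apply, Fin.sum_univ_two, conj_invSqrtTwo] <;> grind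
  · refine ⟨_, -1, hH, by simp, hc _ _ _ fun x y => ?_⟩
    fin_cases x <;> fin_cases y <;>
      simp [Matrix.mul_apply, Fin.sum_univ_two, conj_invSqrtTwo] <;> grind
  · exact ⟨1, 1, by simp, by simp, by simp⟩
  · exact ⟨1, -1, by simp, by simp, by simp⟩
  · refine ⟨_, -Complex.I, hI, by simp, hc _ _ _ fun x y => ?_⟩
    fin_cases x <;> fin_cases y <;> simp [Matrix.mul_apply, Fin.sum_univ_two]
  · refine ⟨_, Complex.I, hI, by simp, hc _ _ _ fun x y => ?_⟩
    fin_cases x <;> fin_cases y <;> simp [Matrix.mul_apply, Fin.sum_univ_two]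

/-- Local unitaries mapping two Bell states to the two with real nonnegative amplitudes, up to
phases. -/
lemma exists_local_unitaries {i j : Fin 4} (hij : i ≠ j) :
    ∃ (U V : Matrix (Fin 2) (Fin 2) ℂ) (c : Fin 2 → ℂ), Uᴴ * U = 1 ∧ Vᴴ * V = 1 ∧
      (∀ e, ‖c e‖ = 1) ∧ ∀ e x, ((U ⊗ₖ V) *ᵥ bellVec (![i, j] e)) x =
        if x.2 = x.1 + e then invSqrtTwo * c e else 0 := by
  obtain ⟨W, c, hW, hc, h⟩ := exists_unitary_conj_bellMat hij
  have hW' : W * Wᴴ = 1 := mul_eq_one_comm.1 hW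
  have hVt : ((Wᴴ)ᵀ)ᵀ = Wᴴ := Matrix.transpose_transpose _
  have hi : (bellMat i)ᴴ * bellMat i = 1 := mul_eq_one_comm.1 (bellMat_mul_conjTranspose i)
  -- With B the Bell matrices, U B_i Vᵀ = W W† = 1 and U B_j Vᵀ = W B_i† B_j W† = c X.
  refine ⟨W * (bellMat i)ᴴ, (Wᴴ)ᵀ, ![1, c], ?_, ?_, ?_, ?_⟩
  · rw [Matrix.conjTranspose_mul, Matrix.conjTranspose_conjTranspose, Matrix.mul_assoc,
      ← Matrix.mul_assoc Wᴴ, hW, Matrix.one_mul, bellMat_mul_conjTranspose]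
  · have hWt : ((Wᴴ)ᵀ)ᴴ = Wᵀ := by
      ext x y
      simp
    rw [hWt, ← Matrix.transpose_mul, hW, Matrix.transpose_one]
  · intro e
    fin_cases e <;> simp [hc]
  · intro e x
    rw [kronecker_mulVec_bellVec, hVt]
    have he : W * (bellMat i)ᴴ * bellMat (![i, j] e) * Wᴴ =
        Matrix.of fun x y => if y = x + e then ![1, c] e else 0 := by
      rw [Matrix.mul_assoc W]
      fin_cases e
      · simp only [Fin.zero_eta, Matrix.cons_val_zero, hi, Matrix.mul_one, hW', add_zero]
        ext x y
        simp [Matrix.one_apply, eq_comm]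
      · simp only [Fin.mk_one, Matrix.cons_val_one, Matrix.cons_val_zero, h]
        ext x y
        fin_cases x <;> fin_cases y <;> simp
    rw [he]
    simp [mul_ite]

/-- Hashing bound at finite block length for a mixture of two Bell states. -/
lemma exists_hashing_fidelity {i j : Fin 4} (hij : i ≠ j) (p : Fin 2 → ℝ) (hp : ∀ e, 0 ≤ p e)
    (hp1 : ∑ e, p e = 1) {n k : ℕ} (hn : n ≠ 0) (hk : k ≤ n) (T : Finset (Fin n → Fin 2)) :
    ∃ P : Matrix ((Fin n → Fin 2) × (Fin n → Fin 2)) ((Fin n → Fin 2) × (Fin n → Fin 2)) ℂ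
        →ₗ[ℂ] Matrix (Fin (2 ^ k) × Fin (2 ^ k)) (Fin (2 ^ k) × Fin (2 ^ k)) ℂ,
      IsSeparableSuperoperator P ∧
      ∑ e ∈ T, ∏ l, p (e l) - (T.card : ℝ) * 2 ^ k / 2 ^ n ≤
        fidelity (P (tensorPower (∑ e, (p e : ℂ) • pureState (bellVec (![i, j] e))) n)) := by
  classical
  have hpJ : ∀ e : Fin n → Fin 2, 0 ≤ ∏ l, p (e l) := fun e => Finset.prod_nonneg fun l _ => hp _
  obtain ⟨C, hC, hCT⟩ := exists_linear_code hn hk T (fun e => ∏ l, p (e l)) hpJ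
  rw [sum_prod_eq_pow, hp1, one_pow, mul_one] at hCT
  obtain ⟨U, V, c, hU, hV, hc, hUV⟩ := exists_local_unitaries hij
  -- The decoder picks an element of T in the observed coset if there is one. It fails on e ∈ T only
  -- if another element of T lies in the same coset, which is the event bounded by `hCT`.
  let d : (Fin n → Fin 2) ⧸ C → (Fin n → Fin 2) := fun t =>
    if h : ∃ e ∈ T, (e : (Fin n → Fin 2) ⧸ C) = t then h.choose else Quotient.out t
  have hd : ∀ t, (d t : (Fin n → Fin 2) ⧸ C) = t := by
    intro t
    simp only [d]
    split_ifs with h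
    · exact h.choose_spec.2
    · exact Quotient.out_eq' t
  have hdT : ∀ e ∈ T, d e ∈ T := by
    intro e he
    have h : ∃ e' ∈ T, (e' : (Fin n → Fin 2) ⧸ C) = e := ⟨e, he, rfl⟩
    simp only [d, dif_pos h]
    exact h.choose_spec.1
  obtain ⟨P, hP, hPe⟩ := exists_hashing_superoperator C d hd hC (matPow U n) (matPow V n)
    (matPow_conjTranspose_mul_self hU n) (matPow_conjTranspose_mul_self hV n)
  refine ⟨P, hP, ?_⟩
  have hgood : ∀ e : Fin n → Fin 2, d e = e →
      1 ≤ fidelity (P (pureState (vecPow (fun e => bellVec (![i, j] e)) e))) := by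
    intro e he
    refine hPe e _ (∏ l, invSqrtTwo * c (e l)) he ?_ ?_
    · rw [norm_prod, ← Finset.prod_pow]
      simp only [norm_mul, hc, mul_one, norm_invSqrtTwo_sq]
      simp
    · rw [matPow_kronecker_mulVec_vecPow]
      ext x
      simp only [vecPow, hUV]
      rw [Finset.prod_ite_zero]
      simp [funext_iff]
  have hbad := hCT {e ∈ T | d e ≠ e} (Finset.filter_subset _ _) (by
    intro e he
    obtain ⟨heT, hne⟩ := Finset.mem_filter.1 he
    refine ⟨d e, hdT e heT, hne, ?_⟩
    rw [← QuotientAddGroup.eq_zero_iff, QuotientAddGroup.mk_sub, hd, sub_self])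
  rw [fidelity_tensorPower_mixture]
  have hsplit := Finset.sum_filter_add_sum_filter_not T (fun e : Fin n → Fin 2 => d e ≠ e)
    (fun e : Fin n → Fin 2 => ∏ l, p (e l))
  calc ∑ e ∈ T, ∏ l, p (e l) - (T.card : ℝ) * 2 ^ k / 2 ^ n
      ≤ ∑ e ∈ T.filter (fun e : Fin n → Fin 2 => ¬ d e ≠ e), ∏ l, p (e l) := by linarith
    _ ≤ ∑ e ∈ T.filter (fun e : Fin n → Fin 2 => ¬ d e ≠ e), (∏ l, p (e l)) *
          fidelity (P (pureState (vecPow (fun e => bellVec (![i, j] e)) e))) := by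
        refine Finset.sum_le_sum fun e he => le_mul_of_one_le_right (hpJ e) (hgood e ?_)
        exact not_not.1 (Finset.mem_filter.1 he).2
    _ ≤ _ := Finset.sum_le_univ_sum_of_nonneg fun e =>
        mul_nonneg (hpJ e) (hP.fidelity_pureState_nonneg _)

/-! ### Typical sequences -/

/-- Typical sequences: a set of at most `exp (n r)` sequences carrying all but an exponentially
small fraction of the probability, for `r` greater than the entropy. -/
lemma exists_typical_set {ι : Type*} [Fintype ι] (p : ι → ℝ) (hp : ∀ j, 0 ≤ p j)
    (hp1 : ∑ j, p j = 1) {r : ℝ} (hr : ∑ j, Real.negMulLog (p j) < r) :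
    ∃ c : ℝ, 0 ≤ c ∧ c < 1 ∧ ∀ n : ℕ, ∃ T : Finset (Fin n → ι),
      (T.card : ℝ) ≤ Real.exp (n * r) ∧ 1 - c ^ n ≤ ∑ e ∈ T, ∏ l, p (e l) := by
  classical
  obtain ⟨s, hs0, -, hs⟩ := exists_exp_moment_lt_one p (fun j => -Real.log (p j)) hp1 (r := r)
    (by simpa [Real.negMulLog] using hr)
  refine ⟨_, Finset.sum_nonneg fun j _ => mul_nonneg (hp j) (Real.exp_pos _).le, hs, fun n => ?_⟩
  have hpJ : ∀ e : Fin n → ι, 0 ≤ ∏ l, p (e l) := fun e => Finset.prod_nonneg fun l _ => hp _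
  have htot : ∑ e : Fin n → ι, ∏ l, p (e l) = 1 := by rw [sum_prod_eq_pow, hp1, one_pow]
  -- Sequences of probability above exp(-n r) number at most exp(n r). The remaining mass is bounded
  -- by Chernoff for -log p, whose mean is the entropy.
  refine ⟨Finset.univ.filter fun e => Real.exp (-(n * r)) < ∏ l, p (e l), ?_, ?_⟩
  · have h : ((Finset.univ.filter fun e : Fin n → ι => Real.exp (-(n * r)) < ∏ l, p (e l)).card : ℝ)
        * Real.exp (-(n * r)) ≤ 1 := by
      rw [← nsmul_eq_mul, ← Finset.sum_const, ← htot]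
      refine (Finset.sum_le_sum fun e he => (Finset.mem_filter.1 he).2.le).trans
        (Finset.sum_le_univ_sum_of_nonneg hpJ)
    have h2 := mul_le_mul_of_nonneg_right h (Real.exp_pos (n * r)).le
    rwa [mul_assoc, ← Real.exp_add, neg_add_cancel, Real.exp_zero, mul_one, one_mul] at h2
  · have hsplit := Finset.sum_filter_add_sum_filter_not Finset.univ
      (fun e : Fin n → ι => Real.exp (-(n * r)) < ∏ l, p (e l)) (fun e => ∏ l, p (e l))
    rw [htot] at hsplit
    have hle : ∑ e ∈ Finset.univ.filter (fun e : Fin n → ι => ¬ Real.exp (-(n * r)) < ∏ l, p (e l)),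
        ∏ l, p (e l) ≤ (∑ j, p j * Real.exp (s * (-Real.log (p j) - r))) ^ n := by
      rw [← sum_prod_eq_pow]
      refine (Finset.sum_le_sum fun e he => ?_).trans (Finset.sum_le_univ_sum_of_nonneg
        fun e => Finset.prod_nonneg fun l _ => mul_nonneg (hp _) (Real.exp_pos _).le)
      rw [Finset.prod_mul_distrib, ← Real.exp_sum]
      -- Null sequences are separated because log 0 = 0 would break the comparison; both sides
      -- vanish on them.
      rcases (hpJ e).eq_or_lt with h0 | h0
      · rw [← h0, zero_mul]
      · refine le_mul_of_one_le_right (hpJ e) (Real.one_le_exp ?_)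
        have h1 := not_lt.1 (Finset.mem_filter.1 he).2
        rw [← Real.log_le_iff_le_exp h0,
          Real.log_prod fun l hl => (Finset.prod_ne_zero_iff.1 h0.ne') l hl] at h1
        rw [← Finset.mul_sum, Finset.sum_sub_distrib, Finset.sum_neg_distrib]
        simp only [Finset.sum_const, Finset.card_univ, Fintype.card_fin, nsmul_eq_mul]
        exact mul_nonneg hs0.le (by linarith)
    linarith

/-! ### The set of achievable rates -/

lemma trace_tensorPower {v : Type*} [Fintype v] (ρ : Matrix (v × v) (v × v) ℂ) (n : ℕ) :
    (tensorPower ρ n).trace = ρ.trace ^ n := by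
  simp only [Matrix.trace, Matrix.diag_apply, tensorPower, Matrix.of_apply]
  rw [Finset.sum_pow', Fintype.piFinset_univ]
  exact (Equiv.sum_comp (Equiv.arrowProdEquivProdArrow (Fin n) (fun _ => v) (fun _ => v))
    (fun x => ∏ k, ρ (x.1 k, x.2 k) (x.1 k, x.2 k))).symm

section rates

variable {v : Type*} [Fintype v] [DecidableEq v]

/-- A rate is achievable as soon as it can be approximated together with fidelity one. -/
lemma mem_separableRates_of_forall_approx {ρ : Matrix (v × v) (v × v) ℂ} {R : ℝ}
    (h : ∀ ε > 0, ∃ (n K : ℕ)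
      (P : Matrix ((Fin n → v) × (Fin n → v)) ((Fin n → v) × (Fin n → v)) ℂ
        →ₗ[ℂ] Matrix (Fin K × Fin K) (Fin K × Fin K) ℂ),
      0 < n ∧ 0 < K ∧ IsSeparableSuperoperator P ∧
      dist (fidelity (P (tensorPower ρ n))) 1 < ε ∧ dist (Real.logb 2 K / (n : ℝ)) R < ε) :
    R ∈ separableRates ρ := by
  have hpos : ∀ i : ℕ, 0 < 1 / ((i : ℝ) + 1) := fun i => Nat.one_div_pos_of_nat
  choose n K P hn hK hP hF hR using fun i : ℕ => h _ (hpos i)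
  exact ⟨n, K, P, hn, hK, hP,
    tendsto_iff_dist_tendsto_zero.2 (squeeze_zero (fun _ => dist_nonneg) (fun i => (hF i).le)
      tendsto_one_div_add_atTop_nhds_zero_nat),
    tendsto_iff_dist_tendsto_zero.2 (squeeze_zero (fun _ => dist_nonneg) (fun i => (hR i).le)
      tendsto_one_div_add_atTop_nhds_zero_nat)⟩

/-- A diagonal argument over protocols for nearby rates; it makes the supremum a maximum. -/
lemma isClosed_separableRates (ρ : Matrix (v × v) (v × v) ℂ) : IsClosed (separableRates ρ) := by
  refine isClosed_of_closure_subset fun R hR => mem_separableRates_of_forall_approx fun ε hε => ?_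
  obtain ⟨R', ⟨n, K, P, hn, hK, hP, hF, hR'⟩, hd⟩ := Metric.mem_closure_iff.1 hR (ε / 2) (half_pos hε)
  obtain ⟨i, h1, h2⟩ := ((Metric.tendsto_nhds.1 hF ε hε).and
    (Metric.tendsto_nhds.1 hR' (ε / 2) (half_pos hε))).exists
  refine ⟨n i, K i, P i, hn i, hK i, hP i, h1, ?_⟩
  have := dist_triangle_right (Real.logb 2 (K i) / (n i : ℝ)) R R'
  linarith

/-- The trace is a separable superoperator, so that the rate zero is achievable. -/
lemma zero_mem_separableRates {ρ : Matrix (v × v) (v × v) ℂ} (hρ : ρ.trace = 1) :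
    (0 : ℝ) ∈ separableRates ρ := by
  refine mem_separableRates_of_forall_approx fun ε hε => ?_
  let A : (Fin 1 → v) → Matrix (Fin 1) (Fin 1 → v) ℂ := fun x => relabel fun _ => x
  have hA : ∑ x, (A x)ᴴ * A x = 1 := by
    refine sum_relabel_conjTranspose_mul (fun (x : Fin 1 → v) (_ : Fin 1) => x) ⟨?_, fun x => ⟨(x, 0), rfl⟩⟩
    rintro ⟨x, k⟩ ⟨y, l⟩ h
    exact Prod.ext h (Subsingleton.elim _ _)
  refine ⟨1, 1, _, one_pos, one_pos, isSeparableSuperoperator_oneWay A (fun _ => A) hA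
    (fun _ => hA), ?_, by simpa using hε⟩
  have h1 : ∀ M : Matrix (Fin 1 × Fin 1) (Fin 1 × Fin 1) ℂ, fidelity M = M.trace.re := by
    intro M
    simp [fidelity, maxEntangled, Matrix.trace, dotProduct, Matrix.mulVec, Fintype.sum_prod_type]
  have h2 : (krausMap (fun i : (Fin 1 → v) × (Fin 1 → v) => A i.1 ⊗ₖ A i.2)
      (tensorPower ρ 1)).trace = (tensorPower ρ 1).trace := by
    have h3 : ∑ i : (Fin 1 → v) × (Fin 1 → v), (A i.1 ⊗ₖ A i.2)ᴴ * (A i.1 ⊗ₖ A i.2) = 1 := by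
      rw [← Matrix.one_kronecker_one, ← hA, Fintype.sum_prod_type]
      ext x y
      simp only [Matrix.conjTranspose_kronecker, ← Matrix.mul_kronecker_mul, Matrix.sum_apply,
        Matrix.kroneckerMap_apply, Finset.mul_sum, Finset.sum_mul]
      rw [Finset.sum_comm]
    simp only [krausMap, LinearMap.coe_mk, AddHom.coe_mk, Matrix.trace_sum]
    calc _ = ∑ i : (Fin 1 → v) × (Fin 1 → v),
          ((A i.1 ⊗ₖ A i.2)ᴴ * (A i.1 ⊗ₖ A i.2) * tensorPower ρ 1).trace :=
          Finset.sum_congr rfl fun i _ => by rw [Matrix.trace_mul_comm, Matrix.mul_assoc]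
      _ = _ := by rw [← Matrix.trace_sum, ← Matrix.sum_mul, h3, Matrix.one_mul]
  rw [h1, h2, trace_tensorPower, hρ]
  simpa using hε

end rates

/-! ### Rates for Bell-diagonal states -/

lemma trace_bellDiagonal (β : Fin 4 → ℝ) (σ : Equiv.Perm (Fin 4)) (hsum : ∑ k, β k = 1) :
    (bellDiagonal β σ).trace = 1 := by
  rw [bellDiagonal_eq, Matrix.trace_sum]
  simp only [Matrix.trace_smul, (isDensity_pureState (sqNorm_bellVec _)).2, smul_eq_mul, mul_one]
  rw [← Complex.ofReal_sum, hsum, Complex.ofReal_one]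

/-- The hashing bound upper bounds all rates of separable distillation. -/
lemma le_of_mem_separableRates_bellDiagonal {β : Fin 4 → ℝ} (σ : Equiv.Perm (Fin 4))
    (hnonneg : ∀ k, 0 ≤ β k) (hsum : ∑ k, β k = 1) {R : ℝ}
    (hR : R ∈ separableRates (bellDiagonal β σ)) : R ≤ 1 - H₂ (β 0) := by
  by_contra! hlt
  obtain ⟨R', h1, h2⟩ := exists_between hlt
  obtain ⟨c, hc0, hc1, hc⟩ := exists_fidelity_sq_le_pow σ hnonneg hsum h1
  obtain ⟨n, K, P, hn, hK, hP, hF, hrate⟩ := hR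
  -- The block lengths of a rate need not grow. Positivity of `n i` gives c^n ≤ c, which already
  -- keeps the fidelity away from 1.
  have hev : ∀ᶠ i in atTop, fidelity (P i (tensorPower (bellDiagonal β σ) (n i))) ^ 2 ≤ c := by
    filter_upwards [hrate.eventually (lt_mem_nhds h2)] with i hi
    refine (hc (n i) (K i) (P i) (hP i) (hK i) ?_).trans (pow_le_of_le_one hc0 hc1.le (hn i).ne')
    rw [lt_div_iff₀ (Nat.cast_pos.2 (hn i))] at hi
    linarith
  have := le_of_tendsto (hF.pow 2) hev
  linarith

/-- All rates below the hashing bound are achieved when at most two eigenvalues are nonzero. -/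
lemma mem_separableRates_of_lt {β : Fin 4 → ℝ} (σ : Equiv.Perm (Fin 4))
    (hnonneg : ∀ k, 0 ≤ β k) (hsum : ∑ k, β k = 1) (h2 : β 2 = 0) (h3 : β 3 = 0) {R : ℝ}
    (hR0 : 0 ≤ R) (hR : R < 1 - H₂ (β 0)) : R ∈ separableRates (bellDiagonal β σ) := by
  have hl2 : 0 < Real.log 2 := Real.log_pos (by norm_num)
  rw [Fin.sum_univ_four, h2, h3, add_zero, add_zero] at hsum
  have hij : σ 0 ≠ σ 1 := σ.injective.ne (by decide)
  set p : Fin 2 → ℝ := ![β 0, β 1] with hpdef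
  have hp : ∀ e, 0 ≤ p e := fun e => by fin_cases e <;> simp [hpdef, hnonneg]
  have hp1 : ∑ e, p e = 1 := by simpa [hpdef] using hsum
  have hbell : bellDiagonal β σ = ∑ e, (p e : ℂ) • pureState (bellVec (![σ 0, σ 1] e)) := by
    rw [bellDiagonal_eq, Fin.sum_univ_four, Fin.sum_univ_two, h2, h3]
    simp [hpdef]
  have hent : ∑ e, Real.negMulLog (p e) = H₂ (β 0) * Real.log 2 := by
    rw [H₂, div_mul_cancel₀ _ hl2.ne', Real.binEntropy_eq_negMulLog_add_negMulLog_one_sub]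
    simp [hpdef, show β 1 = 1 - β 0 by linarith]
  -- With r between the entropy and (1 - R) log 2, both the atypical mass and the collision term
  -- exp(n r) 2^(R n) / 2^n decay exponentially.
  obtain ⟨r, hr1, hr2⟩ := exists_between (show H₂ (β 0) * Real.log 2 < (1 - R) * Real.log 2 from
    mul_lt_mul_of_pos_right (by linarith) hl2)
  obtain ⟨c, hc0, hc1, hc⟩ := exists_typical_set p hp hp1 (hent.trans_lt hr1)
  have hR1 : R ≤ 1 := by
    have hH : 0 ≤ H₂ (β 0) := div_nonneg (Real.binEntropy_nonneg (hnonneg 0)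
      (by linarith [hnonneg 1])) hl2.le
    linarith
  choose T hT1 hT2 using hc
  have hfloor : ∀ n : ℕ, ⌊R * (n : ℝ)⌋₊ ≤ n := fun n => Nat.floor_le_of_le
    (mul_le_of_le_one_left (Nat.cast_nonneg n) hR1)
  choose P hP hPF using fun i : ℕ =>
    exists_hashing_fidelity hij p hp hp1 (Nat.succ_ne_zero i) (hfloor (i + 1)) (T (i + 1))
  refine ⟨fun i => i + 1, fun i => 2 ^ ⌊R * ((i + 1 : ℕ) : ℝ)⌋₊, P, fun i => Nat.succ_pos i,
    fun i => by positivity, hP, ?_, ?_⟩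
  · set x : ℝ := Real.exp (r - (1 - R) * Real.log 2) with hx
    have hx1 : x < 1 := by
      rw [hx, Real.exp_lt_one_iff]
      linarith
    have hcode : ∀ n : ℕ, ((T n).card : ℝ) * 2 ^ ⌊R * (n : ℝ)⌋₊ / 2 ^ n ≤ x ^ n := by
      intro n
      have h2e : ∀ m : ℕ, (2 : ℝ) ^ m = Real.exp (m * Real.log 2) := fun m => by
        rw [Real.exp_nat_mul, Real.exp_log two_pos]
      have hf : (2 : ℝ) ^ ⌊R * (n : ℝ)⌋₊ ≤ Real.exp (R * n * Real.log 2) := by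
        rw [h2e, Real.exp_le_exp]
        exact mul_le_mul_of_nonneg_right
          (Nat.floor_le (mul_nonneg hR0 (Nat.cast_nonneg n))) hl2.le
      rw [div_le_iff₀ (by positivity)]
      calc ((T n).card : ℝ) * 2 ^ ⌊R * (n : ℝ)⌋₊
          ≤ Real.exp (n * r) * Real.exp (R * n * Real.log 2) :=
            mul_le_mul (hT1 n) hf (by positivity) (Real.exp_pos _).le
        _ = x ^ n * 2 ^ n := by
            rw [h2e n, hx, ← Real.exp_nat_mul, ← Real.exp_add, ← Real.exp_add]
            congr 1
            ring
    have hlow : Tendsto (fun i : ℕ => 1 - c ^ (i + 1) - x ^ (i + 1)) atTop (𝓝 1) := by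
      have e1 := (tendsto_pow_atTop_nhds_zero_of_lt_one hc0 hc1).comp (tendsto_add_atTop_nat 1)
      have e2 := (tendsto_pow_atTop_nhds_zero_of_lt_one (Real.exp_pos _).le hx1).comp
        (tendsto_add_atTop_nat 1)
      simpa using (tendsto_const_nhds.sub e1).sub e2
    refine tendsto_of_tendsto_of_tendsto_of_le_of_le hlow tendsto_const_nhds (fun i => ?_)
      (fun i => ?_)
    · have e1 := hPF i
      have e2 := hT2 (i + 1)
      have e3 := hcode (i + 1)
      simp only [hbell]
      simp only [Nat.succ_eq_add_one] at e1
      linarith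
    · simp only [hbell]
      exact ((hP i).fidelity_mixture_mem_Icc p hp hp1 _ fun e => sqNorm_bellVec _).2
  · have h := (tendsto_nat_floor_mul_div_atTop (R := ℝ) hR0).comp
      (tendsto_natCast_atTop_atTop.comp (tendsto_add_atTop_nat 1))
    refine h.congr fun i => ?_
    simp only [Function.comp, Nat.cast_pow, Nat.cast_ofNat, Real.logb_pow]
    rw [Real.logb_self_eq_one one_lt_two, mul_one]

theorem mainTheorem4 (β : Fin 4 → ℝ) (σ : Equiv.Perm (Fin 4))
    (hanti : Antitone β) (hnonneg : ∀ k, 0 ≤ β k) (hsum : ∑ k, β k = 1)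
    (hhalf : 1 / 2 ≤ β 0) :
    -- the supremum defining `D_*` is a maximum, and it satisfies the bound
    IsGreatest (separableRates (bellDiagonal β σ)) (Dstar (bellDiagonal β σ)) ∧
    Dstar (bellDiagonal β σ) ≤ 1 - H₂ (β 0) ∧
    -- above this rate the output fidelity tends to 0
    (∀ (n K : ℕ → ℕ)
      (P : ∀ i, Matrix ((Fin (n i) → Fin 2) × (Fin (n i) → Fin 2))
          ((Fin (n i) → Fin 2) × (Fin (n i) → Fin 2)) ℂ
        →ₗ[ℂ] Matrix (Fin (K i) × Fin (K i)) (Fin (K i) × Fin (K i)) ℂ) (R : ℝ),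
      (∀ i, IsSeparableSuperoperator (P i)) → Tendsto n atTop atTop →
      1 - H₂ (β 0) < R → (∀ᶠ i in atTop, R ≤ Real.logb 2 (K i) / (n i : ℝ)) →
      Tendsto (fun i => fidelity (P i (tensorPower (bellDiagonal β σ) (n i)))) atTop (𝓝 0)) ∧
    -- the comparison state
    (β 0 < 1 →
      IsGreatest (Set.range (comparisonEigenvalues β)) (1 / 2) ∧
      IsSeparableState (bellDiagonal (comparisonEigenvalues β) σ) ∧
      ∀ (n K : ℕ)
        (P : Matrix ((Fin n → Fin 2) × (Fin n → Fin 2)) ((Fin n → Fin 2) × (Fin n → Fin 2)) ℂ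
          →ₗ[ℂ] Matrix (Fin K × Fin K) (Fin K × Fin K) ℂ),
        IsSeparableSuperoperator P →
        fidelity (P (tensorPower (bellDiagonal (comparisonEigenvalues β) σ) n)) ≤ 1 / (K : ℝ)) ∧
    -- tightness
    (β 2 = 0 → β 3 = 0 → Dstar (bellDiagonal β σ) = 1 - H₂ (β 0)) := by
  have hl2 : 0 < Real.log 2 := Real.log_pos (by norm_num)
  have hle : β 0 ≤ 1 := hsum ▸ Finset.single_le_sum (fun k _ => hnonneg k) (Finset.mem_univ 0)
  have hzero := zero_mem_separableRates (trace_bellDiagonal β σ hsum)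
  have hub : ∀ R ∈ separableRates (bellDiagonal β σ), R ≤ 1 - H₂ (β 0) := fun R hR =>
    le_of_mem_separableRates_bellDiagonal σ hnonneg hsum hR
  have hbdd : BddAbove (separableRates (bellDiagonal β σ)) := ⟨_, hub⟩
  have hDle : Dstar (bellDiagonal β σ) ≤ 1 - H₂ (β 0) := csSup_le ⟨0, hzero⟩ hub
  refine ⟨⟨(isClosed_separableRates _).csSup_mem ⟨0, hzero⟩ hbdd, fun R hR => le_csSup hbdd hR⟩,
    hDle, ?_, fun h1 => ⟨⟨⟨0, rfl⟩, ?_⟩, ?_, ?_⟩, fun h2 h3 => le_antisymm hDle ?_⟩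
  · intro n K P R hP hn hR hrate
    obtain ⟨c, hc0, hc1, hc⟩ := exists_fidelity_sq_le_pow σ hnonneg hsum hR
    -- Positivity of R excludes K = 0, where `Real.logb` takes the default value 0.
    have hR0 : 0 < R := by
      have : H₂ (β 0) ≤ 1 := (div_le_one hl2).2 Real.binEntropy_le_log_two
      linarith
    have hsq : Tendsto (fun i => fidelity (P i (tensorPower (bellDiagonal β σ) (n i))) ^ 2)
        atTop (𝓝 0) := by
      refine squeeze_zero' (Eventually.of_forall fun i => sq_nonneg _) ?_
        ((tendsto_pow_atTop_nhds_zero_of_lt_one hc0 hc1).comp hn)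
      filter_upwards [hrate, hn.eventually_gt_atTop 0] with i hi hni
      have hni' : (0 : ℝ) < n i := Nat.cast_pos.2 hni
      rw [le_div_iff₀ hni'] at hi
      refine hc (n i) (K i) (P i) (hP i) (Nat.pos_of_ne_zero fun h0 => ?_) (by linarith)
      rw [h0, Nat.cast_zero, Real.logb_zero] at hi
      exact absurd hi (not_le.2 (mul_pos hR0 hni'))
    have hsqrt := hsq.sqrt
    simp only [Real.sqrt_sq_eq_abs, Real.sqrt_zero] at hsqrt
    exact (tendsto_zero_iff_abs_tendsto_zero _).2 hsqrt
  · rintro _ ⟨k, rfl⟩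
    have hpos : 0 < 2 - 2 * β 0 := by linarith
    have hb : ∀ k, k ≠ 0 → β k / (2 - 2 * β 0) ≤ 1 / 2 := by
      intro k hk
      have h := Finset.add_le_sum (s := Finset.univ) (fun k _ => hnonneg k) (Finset.mem_univ 0)
        (Finset.mem_univ k) hk.symm
      rw [hsum] at h
      rw [div_le_iff₀ hpos]
      linarith
    fin_cases k
    · exact le_rfl
    · exact hb 1 (by decide)
    · exact hb 2 (by decide)
    · exact hb 3 (by decide)
  · obtain ⟨e1, e2⟩ := comparisonEigenvalues_spec hnonneg hsum h1
    exact isSeparableState_bellDiagonal_half _ σ e1 rfl e2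
  · intro n K P hP
    obtain ⟨e1, e2⟩ := comparisonEigenvalues_spec hnonneg hsum h1
    exact hP.fidelity_bellDiagonal_half_le _ σ e1 rfl e2
  · refine le_of_forall_lt fun R hR => ?_
    obtain ⟨R', h4, h5⟩ := exists_between hR
    -- The hashing construction needs a nonnegative rate; below zero the achievable rate 0 suffices.
    rcases le_or_gt 0 R' with h | h
    · exact h4.trans_le (le_csSup hbdd (mem_separableRates_of_lt σ hnonneg hsum h2 h3 h h5))
    · exact (h4.trans h).trans_le (le_csSup hbdd hzero)
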